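/- Let $\mathcal A$ be a deterministic synchronous two-tape automaton over the alphabet $\{1\}$, reading pairs of words through their convolution, i.e. with letters $(1,1)$, $(1,\diamond)$, $(\diamond,1)$. Call $\mathcal A$ a standard one-loop automaton with loop constant $p\ge 1$ if its transition diagram consists of a $(1,1)$-tail of $p$ states beginning with the initial state, followed by a $(1,1)$-loop of $p$ states, together with, for each of these $2p$ states, a $(1,\diamond)$-tail and a $(\diamond,1)$-tail of $p$ further states leaving it (all these states are distinct, and there are no other states and no other transitions); the set of final states is arbitrary. Let $\mathcal G=(1^\star,E)$ be the unary automatic graph of finite degree whose edge relation $E$ is recognized by $\mathcal A$; graphs are undirected, that is, $E$ is symmetric. **Theorem.** There is a single algorithm (a program of a unit-cost random access machine with addition and subtraction) which solves the reachability problem for these graphs: given any standard one-loop automaton $\mathcal A$ recognizing a symmetric relation, as its transition table and its set of final states, and two words $u,v\in 1^\star$, it decides whether there is a path from $u$ to $v$ in $\mathcal G$. For some constant $C$, which does not depend on $\mathcal A$, $u$ and $v$, the running time is at most $C\cdot(|u|+|v|+p^4)$, where $p$ is the loop constant of $\mathcal A$. In particular the algorithm runs in polynomial time. -/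

import Mathlib

/-! ### Automata over the unary alphabet that read pairs of words -/

/-- The letters of the convolution of two words over `{1}`: `both` is `(1,1)`, `left` is `(1,⋄)`
and `right` is `(⋄,1)`. The letter `(⋄,⋄)` occurs in no convolution. -/
inductive Letter : Type
  | both
  | left
  | right

/-- The convolution of two words over the one-letter alphabet. -/
def conv : List Unit → List Unit → List Letter
  | [], [] => []
  | _ :: u, [] => Letter.left :: conv u []
  | [], _ :: v => Letter.right :: conv [] v
  | _ :: u, _ :: v => Letter.both :: conv u v

/-- A deterministic (partial) synchronous two-tape finite automaton over the unary alphabet, with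
states `0, …, n - 1`. -/
structure UnaryAutomaton (n : ℕ) where
  start : Fin n
  step : Fin n → Letter → Option (Fin n)
  final : Fin n → Bool

namespace UnaryAutomaton

variable {n : ℕ}

/-- The computation of `A` on `w` from state `s` succeeds. -/
def AcceptsFrom (A : UnaryAutomaton n) : Fin n → List Letter → Prop
  | s, [] => A.final s = true
  | s, a :: w => ∃ s', A.step s a = some s' ∧ AcceptsFrom A s' w

/-- The binary relation on `1*` recognized by `A`: the edge relation of the graph with vertex set
`1*` represented by `A`. -/
def Edge (A : UnaryAutomaton n) (u v : List Unit) : Prop :=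
  A.AcceptsFrom A.start (conv u v)

/-- There is a path from `u` to `v` in the graph represented by `A` (possibly of length `0`). -/
def Reachable (A : UnaryAutomaton n) (u v : List Unit) : Prop :=
  Relation.ReflTransGen A.Edge u v

end UnaryAutomaton

/-- The states of a standard one-loop automaton with loop constant `p`: the `2p` `(1,1)`-states
`main i` (those with `i < p` form the `(1,1)`-tail, the others the `(1,1)`-loop) and, for each of
them, the `p` states `leftTail i k` of its `(1,⋄)`-tail and the `p` states `rightTail i k` of its
`(⋄,1)`-tail. -/
inductive StdState (p : ℕ) : Type
  | main (i : Fin (2 * p))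
  | leftTail (i : Fin (2 * p)) (k : Fin p)
  | rightTail (i : Fin (2 * p)) (k : Fin p)

/-- The transitions of a standard one-loop automaton with loop constant `p`. -/
def StdState.next {p : ℕ} (hp : 0 < p) : StdState p → Letter → Option (StdState p)
  | main i, Letter.both =>
      if h : i.1 + 1 < 2 * p then some (main ⟨i.1 + 1, h⟩) else some (main ⟨p, by omega⟩)
  | main i, Letter.left => some (leftTail i ⟨0, hp⟩)
  | main i, Letter.right => some (rightTail i ⟨0, hp⟩)
  | leftTail i k, Letter.left =>
      if h : k.1 + 1 < p then some (leftTail i ⟨k.1 + 1, h⟩) else none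
  | rightTail i k, Letter.right =>
      if h : k.1 + 1 < p then some (rightTail i ⟨k.1 + 1, h⟩) else none
  | _, _ => none

/-- `A` is a standard one-loop automaton with loop constant `p`: up to the names of its states
(given by `e`), its transition diagram is a `(1,1)`-tail of length `p` followed by a `(1,1)`-loop
of length `p`, with a `(1,⋄)`-tail and a `(⋄,1)`-tail of length `p` going out of each of these `2p`
states, and nothing else. The set of final states is arbitrary. -/
def UnaryAutomaton.IsStandardOneLoop {n : ℕ} (A : UnaryAutomaton n) (p : ℕ) : Prop :=
  ∃ (hp : 0 < p) (e : StdState p ≃ Fin n),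
    A.start = e (StdState.main ⟨0, by omega⟩) ∧
      ∀ (s : StdState p) (a : Letter), A.step (e s) a = (StdState.next hp s a).map e

/-! ### Random access machines with unit cost -/

namespace RAM

/-- A configuration: the registers, the memory cells, and the unread part of the input. -/
structure State where
  reg : ℕ → ℕ
  mem : ℕ → ℕ
  input : List ℕ

/-- The elementary instructions. There is no multiplication. -/
inductive Instr : Type
  /-- `x := k` -/
  | const (x k : ℕ)
  /-- `x := y` -/
  | copy (x y : ℕ)
  /-- `x := y + z` -/
  | add (x y z : ℕ)
  /-- `x := max (y - z) 0` -/
  | sub (x y z : ℕ)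
  /-- `x := mem[y]` -/
  | load (x y : ℕ)
  /-- `mem[x] := y` -/
  | store (x y : ℕ)
  /-- move the next input symbol to `x` (`0` when the input is exhausted) -/
  | read (x : ℕ)

/-- `x := a` -/
def State.setReg (s : State) (x a : ℕ) : State :=
  { s with reg := Function.update s.reg x a }

/-- The effect of an elementary instruction. -/
def Instr.run : Instr → State → State
  | const x k, s => s.setReg x k
  | copy x y, s => s.setReg x (s.reg y)
  | add x y z, s => s.setReg x (s.reg y + s.reg z)
  | sub x y z, s => s.setReg x (s.reg y - s.reg z)
  | load x y, s => s.setReg x (s.mem (s.reg y))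
  | store x y, s => { s with mem := Function.update s.mem (s.reg x) (s.reg y) }
  | read x, s => { s.setReg x (s.input.headD 0) with input := s.input.tail }

/-- Programs. A program is a finite object, so it uses finitely many registers; the memory is
addressed indirectly. -/
inductive Prog : Type
  | instr (i : Instr)
  | seq (P Q : Prog)
  /-- if `x ≠ 0` then `P` else `Q` -/
  | cond (x : ℕ) (P Q : Prog)
  /-- while `x ≠ 0` do `P` -/
  | loop (x : ℕ) (P : Prog)

/-- `Exec P s t s'`: started in the configuration `s`, the program `P` halts in the configuration
`s'` after exactly `t` steps. Every elementary instruction and every test is one step. -/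
inductive Exec : Prog → State → ℕ → State → Prop
  | instr (i : Instr) (s : State) : Exec (Prog.instr i) s 1 (i.run s)
  | seq {P Q : Prog} {s s' s'' : State} {t t' : ℕ} :
      Exec P s t s' → Exec Q s' t' s'' → Exec (Prog.seq P Q) s (t + t') s''
  | condTrue {x : ℕ} {P Q : Prog} {s s' : State} {t : ℕ} :
      s.reg x ≠ 0 → Exec P s t s' → Exec (Prog.cond x P Q) s (1 + t) s'
  | condFalse {x : ℕ} {P Q : Prog} {s s' : State} {t : ℕ} :
      s.reg x = 0 → Exec Q s t s' → Exec (Prog.cond x P Q) s (1 + t) s'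
  | loopExit {x : ℕ} {P : Prog} {s : State} :
      s.reg x = 0 → Exec (Prog.loop x P) s 1 s
  | loopStep {x : ℕ} {P : Prog} {s s' s'' : State} {t t' : ℕ} :
      s.reg x ≠ 0 → Exec P s t s' → Exec (Prog.loop x P) s' t' s'' →
        Exec (Prog.loop x P) s (1 + t + t') s''

/-- The initial configuration on input `w`. -/
def init (w : List ℕ) : State where
  reg := fun _ => 0
  mem := fun _ => 0
  input := w

end RAM

/-! ### The input of the reachability problem -/

/-- The code of an entry of the transition table. -/
def encodeTarget {n : ℕ} : Option (Fin n) → ℕ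
  | none => 0
  | some s => s.1 + 1

/-- The automaton as a list of numbers: the number of states, the initial state and, state by
state, the targets of the transitions labelled `(1,1)`, `(1,⋄)`, `(⋄,1)` and a bit that tells
whether the state is final. -/
def UnaryAutomaton.encode {n : ℕ} (A : UnaryAutomaton n) : List ℕ :=
  n :: A.start.1 :: (List.finRange n).flatMap fun s =>
    [encodeTarget (A.step s Letter.both), encodeTarget (A.step s Letter.left),
      encodeTarget (A.step s Letter.right), (A.final s).toNat]

/-- A word over `{1}`, written symbol by symbol and closed by an end marker `0`. -/
def encodeWord (u : List Unit) : List ℕ :=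
  u.map (fun _ => 1) ++ [0]

/-- The input of the reachability problem: an automaton and two vertices. -/
def encodeInput {n : ℕ} (A : UnaryAutomaton n) (u v : List Unit) : List ℕ :=
  A.encode ++ encodeWord u ++ encodeWord v

/-! The words `1^x` are the natural numbers `x`. After `x` letters `(1,1)` the automaton is in a
state that, for `x ≥ p`, depends only on `x` modulo `p`, and its tails have length `p`. So the
graph is an undirected graph on `ℕ` whose edges have length at most `p` and which is invariant
under translation by `p` from `p` on (`IsPeriodicBand`, `isPeriodicBand_adj`).

Paths need not climb high. For a block `[m, m + p)` with `m` a positive multiple of `p`,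
consider the partition of the block by connectivity inside the first `1, 2, 3, …` blocks from
`m` on. These partitions get coarser, by periodicity they are constant once two consecutive ones
agree, and a partition of `p` points can get strictly coarser fewer than `p` times. Hence
connectivity above `m` is already seen inside `p` blocks, and all that matters happens below
`(p + 2) p` (`exists_conn_stable`, `IsPeriodicBand.conn_window`).

The algorithm finds the least vertex of the component of `u` and of `v` and compares them. It
uses a table of descents (`IsDescent`): at each vertex `q` a number `e` such that `q - e` is in
the component of `q`, with `e = 0` only at the least vertex of a component. Subtracting `e`
again and again takes at most `|u|` steps. If `q ≥ 2p` is not the least vertex of its component,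
a path from `q` first falls below `q` at a vertex that is at least `q - p ≥ p`, within the
periodic part of the graph. So for `2p ≤ q < 3p` the descent can be taken to the least vertex
connected to `q` inside `[p, (p + 2) p)`, and it is continued periodically; for `q < 2p` it
leads to the least vertex connected to `q` inside `[0, (p + 2) p)`.

The components are found by a sweep that inserts the vertices in decreasing order
(`IsLabelling.step`). The `(⋄,1)`-tail of the new vertex `x` lists its larger neighbours; their
labels are marked, and all vertices with a marked label, and `x` itself, get the label `x`. So
labels are the least vertices of the components of the swept interval. Each of the `(p + 2) p`
insertions takes `O(p ^ 2)` steps, which gives the term `p ^ 4`; the table of states has only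
`2p + 4p ^ 2` rows.

Programs are verified with total-correctness triples `Halts P h T Q` that bound the number of
steps, over stores of named variables and arrays that are interleaved in the memory of the
machine. -/

/-! ### Connectivity in a periodic band graph on the natural numbers -/

/-- `Conn adj a b x y`: some path from `x` to `y` stays in the interval `[a, b)`. Every number is
connected to itself by the empty path, even outside the interval. -/
def Conn (adj : ℕ → ℕ → Prop) (a b : ℕ) : ℕ → ℕ → Prop :=
  Relation.ReflTransGen fun x y => adj x y ∧ x ∈ Set.Ico a b ∧ y ∈ Set.Ico a b

/-- An undirected graph on `ℕ` whose edges have length at most `p` and which, from `p` on, is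
invariant under translation by `p`. -/
structure IsPeriodicBand (adj : ℕ → ℕ → Prop) (p : ℕ) : Prop where
  symm : ∀ x y, adj x y → adj y x
  band : ∀ x y, adj x y → y ≤ x + p
  shift : ∀ x y, p ≤ x → p ≤ y → (adj (x + p) (y + p) ↔ adj x y)

section Graph

variable {adj : ℕ → ℕ → Prop} {p : ℕ}

theorem Conn.mono {a b a' b' x y : ℕ} (ha : a' ≤ a) (hb : b ≤ b') (h : Conn adj a b x y) :
    Conn adj a' b' x y :=
  Relation.ReflTransGen.mono
    (fun _ _ h => ⟨h.1, ⟨ha.trans h.2.1.1, h.2.1.2.trans_le hb⟩,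
      ⟨ha.trans h.2.2.1, h.2.2.2.trans_le hb⟩⟩) _ _ h

theorem Conn.trans {a b x y z : ℕ} (h : Conn adj a b x y) (h' : Conn adj a b y z) :
    Conn adj a b x z :=
  Relation.ReflTransGen.trans h h'

theorem Conn.single {a b x y : ℕ} (h : adj x y) (hx : x ∈ Set.Ico a b) (hy : y ∈ Set.Ico a b) :
    Conn adj a b x y :=
  Relation.ReflTransGen.single ⟨h, hx, hy⟩

theorem Conn.mem {a b x y : ℕ} (h : Conn adj a b x y) (hx : x ∈ Set.Ico a b) :
    y ∈ Set.Ico a b := by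
  induction h with
  | refl => exact hx
  | tail _ h _ => exact h.2.2

theorem Conn.symm (hs : ∀ x y, adj x y → adj y x) {a b x y : ℕ} (h : Conn adj a b x y) :
    Conn adj a b y x := by
  induction h with
  | refl => exact .refl
  | tail _ h ih => exact .head ⟨hs _ _ h.1, h.2.2, h.2.1⟩ ih

theorem Conn.reflTransGen {a b x y : ℕ} (h : Conn adj a b x y) : Relation.ReflTransGen adj x y :=
  Relation.ReflTransGen.mono (fun _ _ h => h.1) _ _ h

theorem exists_conn_of_reflTransGen {x y : ℕ} (h : Relation.ReflTransGen adj x y) :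
    ∃ b, Conn adj 0 b x y := by
  induction h with
  | refl => exact ⟨0, .refl⟩
  | @tail z w _ h ih =>
    obtain ⟨b, hb⟩ := ih
    refine ⟨max b (max z w + 1), (hb.mono le_rfl (le_max_left _ _)).trans (.single h ?_ ?_)⟩ <;>
      simp

theorem reflTransGen_symm (hs : ∀ x y, adj x y → adj y x) {x y : ℕ}
    (h : Relation.ReflTransGen adj x y) : Relation.ReflTransGen adj y x := by
  induction h with
  | refl => exact .refl
  | tail _ h ih => exact .head (hs _ _ h) ih

theorem IsPeriodicBand.shift_mul (hG : IsPeriodicBand adj p) {x y : ℕ} (hx : p ≤ x) (hy : p ≤ y)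
    (k : ℕ) : adj (x + k * p) (y + k * p) ↔ adj x y := by
  induction k with
  | zero => simp
  | succ k ih =>
    rw [← ih, Nat.succ_mul, ← add_assoc, ← add_assoc]
    exact hG.shift _ _ (by omega) (by omega)

theorem IsPeriodicBand.conn_shift (hG : IsPeriodicBand adj p) {a b x y : ℕ} (ha : p ≤ a) (k : ℕ) :
    Conn adj (a + k * p) (b + k * p) (x + k * p) (y + k * p) ↔ Conn adj a b x y := by
  constructor
  · intro h
    have key : ∀ z w, Conn adj (a + k * p) (b + k * p) z w →
        Conn adj a b (z - k * p) (w - k * p) := by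
      intro z w h
      induction h with
      | refl => exact .refl
      | @tail w w' _ h ih =>
        obtain ⟨h, ⟨h1, h2⟩, h3, h4⟩ := h
        refine ih.trans (.single ?_ ⟨by omega, by omega⟩ ⟨by omega, by omega⟩)
        rw [← hG.shift_mul (by omega) (by omega) k]
        rwa [Nat.sub_add_cancel (by omega), Nat.sub_add_cancel (by omega)]
    simpa using key _ _ h
  · intro h
    induction h with
    | refl => exact .refl
    | @tail w w' _ h ih =>
      obtain ⟨h, ⟨h1, h2⟩, h3, h4⟩ := h
      exact ih.trans (.single ((hG.shift_mul (by omega) (by omega) k).2 h)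
        ⟨by omega, by omega⟩ ⟨by omega, by omega⟩)

/-- Excursions above the block `[m, m + p)` enter and leave it through the block, because edges
have length at most `p`. So if the ceiling of paths that start and end in the block and stay above
`m` can be lowered from `b'` to `b`, then the same holds for all paths between vertices below
`m + p`. -/
theorem IsPeriodicBand.conn_lower_ceiling (hG : IsPeriodicBand adj p) {a b b' m : ℕ} (ham : a ≤ m)
    (hb : m + p ≤ b)
    (hm : ∀ w ∈ Set.Ico m (m + p), ∀ z ∈ Set.Ico m (m + p), Conn adj m b' w z → Conn adj m b w z)
    {x y : ℕ} (hx : x < m + p) (hy : y < m + p) (h : Conn adj a b' x y) : Conn adj a b x y := by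
  have key : (y < m + p ∧ Conn adj a b x y) ∨ (m + p ≤ y ∧ ∃ w ∈ Set.Ico m (m + p),
      Conn adj a b x w ∧ Conn adj m b' w y) := by
    clear hy
    induction h with
    | refl => exact .inl ⟨hx, .refl⟩
    | @tail z z' _ h ih =>
      obtain ⟨h, ⟨h1, h2⟩, h3, h4⟩ := h
      have hz := hG.band _ _ h
      have hz' := hG.band _ _ (hG.symm _ _ h)
      rcases ih with ⟨hlt, hc⟩ | ⟨hle, w, hw, hc, hc'⟩
      · by_cases hlt' : z' < m + p
        · exact .inl ⟨hlt', hc.trans (.single h ⟨h1, by omega⟩ ⟨h3, by omega⟩)⟩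
        · exact .inr ⟨by omega, z, ⟨by omega, hlt⟩, hc,
            .single h ⟨by omega, h2⟩ ⟨by omega, h4⟩⟩
      · have hc'' : Conn adj m b' w z' := hc'.trans (.single h ⟨by omega, h2⟩ ⟨by omega, h4⟩)
        by_cases hlt' : z' < m + p
        · exact .inl ⟨hlt', hc.trans ((hm w hw z' ⟨by omega, hlt'⟩ hc'').mono ham le_rfl)⟩
        · exact .inr ⟨by omega, w, hw, hc, hc''⟩
  rcases key with h | h
  · exact h.2
  · omega

/-- Connectivity inside the `j + 1` blocks `[p, (j + 2) p)`, seen on the first of these blocks. -/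
def blockSetoid (hs : ∀ x y, adj x y → adj y x) (p j : ℕ) : Setoid (Fin p) where
  r x y := Conn adj p ((j + 2) * p) (p + x) (p + y)
  iseqv := ⟨fun _ => .refl, fun h => h.symm hs, fun h h' => h.trans h'⟩

/-- The partitions of a block by connectivity inside `1, 2, 3, …` blocks get coarser, and a
partition of `p` points can get strictly coarser fewer than `p` times. -/
theorem exists_conn_stable (hs : ∀ x y, adj x y → adj y x) (hp : 0 < p) :
    ∃ j < p, ∀ x ∈ Set.Ico p (p + p), ∀ y ∈ Set.Ico p (p + p),
      Conn adj p ((j + 3) * p) x y → Conn adj p ((j + 2) * p) x y := by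
  classical
  by_contra! hcon
  have key : ∀ j ≤ p, Fintype.card (Quotient (blockSetoid hs p j)) + j ≤ p := by
    intro j
    induction j with
    | zero =>
      intro _
      simpa using Fintype.card_quotient_le (blockSetoid hs p 0)
    | succ j ih =>
      intro hj
      obtain ⟨x, ⟨hx, hx'⟩, y, ⟨hy, hy'⟩, h, h'⟩ := hcon j (by omega)
      have hle : ∀ a b : Fin p, (blockSetoid hs p j) a b → (blockSetoid hs p (j + 1)) a b :=
        fun a b hab => Conn.mono le_rfl (Nat.mul_le_mul_right p (by omega)) hab
      let f : Quotient (blockSetoid hs p j) → Quotient (blockSetoid hs p (j + 1)) :=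
        Quotient.map' id hle
      have hf : Function.Surjective f := by
        rintro ⟨a⟩
        exact ⟨Quotient.mk _ a, rfl⟩
      have hf' : ¬ Function.Injective f := by
        intro hi
        have hxy : (Quotient.mk (blockSetoid hs p j) ⟨x - p, by omega⟩) =
            Quotient.mk (blockSetoid hs p j) ⟨y - p, by omega⟩ := by
          apply hi
          apply Quotient.sound
          change Conn adj p ((j + 1 + 2) * p) (p + (x - p)) (p + (y - p))
          rwa [Nat.add_sub_cancel' hx, Nat.add_sub_cancel' hy]
        have hxy' := Quotient.exact hxy
        change Conn adj p ((j + 2) * p) (p + (x - p)) (p + (y - p)) at hxy'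
        rw [Nat.add_sub_cancel' hx, Nat.add_sub_cancel' hy] at hxy'
        exact h' hxy'
      have := Fintype.card_lt_of_surjective_not_injective f hf hf'
      have := ih (by omega)
      omega
  have h := key p le_rfl
  have : 0 < Fintype.card (Quotient (blockSetoid hs p p)) :=
    Fintype.card_pos_iff.2 ⟨Quotient.mk _ ⟨0, hp⟩⟩
  omega

/-- Two vertices of a block that are connected above the lower end of the block are already
connected inside `p` consecutive blocks. -/
theorem IsPeriodicBand.conn_block (hG : IsPeriodicBand adj p) (hp : 0 < p) {x y b : ℕ}
    (hx : x ∈ Set.Ico p (p + p)) (hy : y ∈ Set.Ico p (p + p)) (h : Conn adj p b x y) :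
    Conn adj p (p + p * p) x y := by
  obtain ⟨j, hj, hst⟩ := exists_conn_stable hG.symm hp
  -- Once two consecutive partitions agree, all later ones do: translate by one block.
  have hst' : ∀ i, ∀ x ∈ Set.Ico p (p + p), ∀ y ∈ Set.Ico p (p + p),
      Conn adj p ((j + i + 3) * p) x y → Conn adj p ((j + i + 2) * p) x y := by
    intro i
    induction i with
    | zero => exact hst
    | succ i ih =>
      intro x hx y hy h
      refine hG.conn_lower_ceiling (m := p + p) (b' := (j + i + 3) * p + p) (by omega) ?_ ?_ ?_ ?_
        (by convert h using 1; ring)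
      · have : 3 * p ≤ (j + (i + 1) + 2) * p := Nat.mul_le_mul_right p (by omega)
        omega
      · intro w hw z hz hwz
        obtain ⟨hw1, hw2⟩ := hw
        obtain ⟨hz1, hz2⟩ := hz
        have e : ∀ w, p + p ≤ w → w - p + 1 * p = w := by intro w hw; omega
        have h1 := hG.conn_shift (a := p) (b := (j + i + 3) * p) (x := w - p) (y := z - p) le_rfl 1
        have h2 := hG.conn_shift (a := p) (b := (j + i + 2) * p) (x := w - p) (y := z - p) le_rfl 1
        rw [e w hw1, e z hz1, one_mul] at h1 h2
        have h3 := h2.2 (ih _ ⟨by omega, by omega⟩ _ ⟨by omega, by omega⟩ (h1.1 hwz))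
        convert h3 using 1
        ring
      · exact hx.2.trans_le (by omega)
      · exact hy.2.trans_le (by omega)
  have hall : ∀ i, Conn adj p ((j + i + 2) * p) x y → Conn adj p ((j + 2) * p) x y := by
    intro i
    induction i with
    | zero => exact id
    | succ i ih => exact fun h => ih (hst' i x hx y hy h)
  have h1 : b ≤ (j + b + 2) * p := by nlinarith
  refine (hall b (h.mono le_rfl h1)).mono le_rfl ?_
  calc (j + 2) * p ≤ (p + 1) * p := Nat.mul_le_mul_right p (by omega)
    _ = p + p * p := by ring

/-- Paths between vertices below the end of the block that starts at `(k + 1) p` need to climb only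
through `p` consecutive blocks. -/
theorem IsPeriodicBand.conn_window (hG : IsPeriodicBand adj p) (hp : 0 < p) (k : ℕ) {a b x y : ℕ}
    (ha : a ≤ p + k * p) (hx : x < p + k * p + p) (hy : y < p + k * p + p) (h : Conn adj a b x y) :
    Conn adj a (p + k * p + p * p) x y := by
  refine hG.conn_lower_ceiling ha ?_ ?_ hx hy (h.mono le_rfl (Nat.le_add_right b (k * p)))
  · nlinarith
  · intro w hw z hz hwz
    obtain ⟨hw1, hw2⟩ := hw
    obtain ⟨hz1, hz2⟩ := hz
    have e : ∀ w, p + k * p ≤ w → w - k * p + k * p = w := by intro w hw; omega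
    have h1 := hG.conn_shift (a := p) (b := b) (x := w - k * p) (y := z - k * p) le_rfl k
    have h2 := hG.conn_shift (a := p) (b := p + p * p) (x := w - k * p) (y := z - k * p) le_rfl k
    rw [e w hw1, e z hz1] at h1 h2
    have h3 := h2.2 (hG.conn_block hp ⟨by omega, by omega⟩ ⟨by omega, by omega⟩ (h1.1 hwz))
    convert h3 using 1
    ring

/-- A path from `x` to a smaller vertex first falls below `x` at a vertex that is at least
`x - p`. -/
theorem IsPeriodicBand.exists_first_descent (hG : IsPeriodicBand adj p) {b x y : ℕ}
    (h : Conn adj 0 b x y) (hy : y < x) : ∃ y' < x, Conn adj (x - p) b x y' := by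
  have key : (x ≤ y ∧ Conn adj (x - p) b x y) ∨ ∃ y' < x, Conn adj (x - p) b x y' := by
    clear hy
    induction h with
    | refl => exact .inl ⟨le_rfl, .refl⟩
    | @tail z z' _ h ih =>
      obtain ⟨h, ⟨h1, h2⟩, h3, h4⟩ := h
      have hz' := hG.band _ _ (hG.symm _ _ h)
      rcases ih with ⟨hle, hc⟩ | ih
      · have hc' := hc.trans (.single h ⟨by omega, h2⟩ ⟨by omega, h4⟩)
        by_cases hlt : z' < x
        · exact .inr ⟨z', hlt, hc'⟩
        · exact .inl ⟨by omega, hc'⟩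
      · exact .inr ih
  rcases key with h | h
  · omega
  · exact h

/-- `e` is a correct descent at the vertex `q`: the vertex `q - e` lies in the component of `q`, and
`e` is zero only if `q` is the least vertex of its component. -/
structure IsDescent (adj : ℕ → ℕ → Prop) (q e : ℕ) : Prop where
  le : e ≤ q
  reach : Relation.ReflTransGen adj q (q - e)
  least : e = 0 → ∀ y, Relation.ReflTransGen adj q y → q ≤ y

theorem IsPeriodicBand.isDescent_low (hG : IsPeriodicBand adj p) (hp : 0 < p) {q l : ℕ}
    (hq : q < p + p) (hl : IsLeast {y | Conn adj 0 ((p + 2) * p) q y} l) :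
    IsDescent adj q (q - l) := by
  have hlq : l ≤ q := hl.2 Relation.ReflTransGen.refl
  refine ⟨Nat.sub_le _ _, ?_, fun h0 y hy => ?_⟩
  · rw [Nat.sub_sub_self hlq]
    exact Conn.reflTransGen hl.1
  · by_contra hlt
    obtain ⟨b, hb⟩ := exists_conn_of_reflTransGen hy
    have h1 := hG.conn_window hp 0 (by omega) (by omega) (by omega) hb
    have := hl.2 (show Conn adj 0 ((p + 2) * p) q y from h1.mono le_rfl (by nlinarith))
    omega

/-- The descent computed at a vertex `q` of the block `[2p, 3p)` inside `[p, (p + 2) p)` is correct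
at all translates of `q`. -/
theorem IsPeriodicBand.isDescent_high (hG : IsPeriodicBand adj p) (hp : 0 < p) {q l : ℕ}
    (hq : p + p ≤ q) (hq' : q < p + p + p) (hl : IsLeast {y | Conn adj p ((p + 2) * p) q y} l)
    (k : ℕ) : IsDescent adj (q + k * p) (q - l) := by
  have hlq : l ≤ q := hl.2 Relation.ReflTransGen.refl
  refine ⟨by omega, ?_, fun h0 y hy => ?_⟩
  · have e : q + k * p - (q - l) = l + k * p := by omega
    rw [e]
    exact ((hG.conn_shift le_rfl k).2 hl.1).reflTransGen
  · by_contra hlt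
    obtain ⟨b, hb⟩ := exists_conn_of_reflTransGen hy
    obtain ⟨y', hy', hc⟩ := hG.exists_first_descent hb (by omega)
    have hc := hc.mono le_rfl (show b ≤ b + (q + k * p + 1) by omega)
    have hm := (hc.mem ⟨by omega, by omega⟩).1
    have e : y' - k * p + k * p = y' := by omega
    have e' : q - p + k * p = q + k * p - p := by omega
    have h1 := (hG.conn_shift (a := q - p) (b := b + (q + k * p + 1)) (x := q) (y := y' - k * p)
      (by omega) k).1 (by rw [e, e']; exact hc.mono le_rfl (by omega))
    have h2 := hG.conn_window hp 1 (a := p) (by omega) (by omega) (by omega)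
      (h1.mono (by omega) le_rfl)
    have := hl.2 (show Conn adj p ((p + 2) * p) q (y' - k * p) from
      h2.mono le_rfl (by nlinarith))
    omega

/-- The labels of a swept interval: every vertex of `[a, b)` carries the least vertex of its
component in the graph induced on `[a, b)`. -/
def IsLabelling (adj : ℕ → ℕ → Prop) (a b : ℕ) (lab : ℕ → ℕ) : Prop :=
  ∀ z ∈ Set.Ico a b, IsLeast {y | Conn adj a b z y} (lab z)

theorem IsLabelling.eq_iff (hs : ∀ x y, adj x y → adj y x) {a b : ℕ} {lab : ℕ → ℕ}
    (h : IsLabelling adj a b lab) {z w : ℕ} (hz : z ∈ Set.Ico a b) (hw : w ∈ Set.Ico a b) :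
    lab z = lab w ↔ Conn adj a b z w := by
  constructor
  · intro e
    have h1 : Conn adj a b z (lab z) := (h z hz).1
    have h2 : Conn adj a b w (lab w) := (h w hw).1
    rw [e] at h1
    exact h1.trans (h2.symm hs)
  · intro hc
    refine le_antisymm ((h z hz).2 (hc.trans (h w hw).1)) ((h w hw).2 ?_)
    exact (hc.symm hs).trans (h z hz).1

/-- When the vertex `x` is put in front of `[x + 1, b)`, a path in `[x, b)` between old vertices
either avoids `x`, or both its ends are connected to neighbours of `x`. -/
theorem conn_insert (hs : ∀ x y, adj x y → adj y x) {x b z y : ℕ} (hz : z ∈ Set.Ico (x + 1) b)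
    (h : Conn adj x b z y) :
    Conn adj (x + 1) b z y ∨ ∃ w ∈ Set.Ico (x + 1) b, adj x w ∧ Conn adj (x + 1) b w z := by
  induction h with
  | refl => exact .inl .refl
  | @tail w w' _ h ih =>
    obtain ⟨h, hw, hw'⟩ := h
    rcases ih with hc | ih
    · have hwm := hc.mem hz
      rcases Nat.eq_or_lt_of_le hw'.1 with e | e
      · subst e
        exact .inr ⟨w, hwm, hs _ _ h, hc.symm hs⟩
      · exact .inl (hc.trans (.single h hwm ⟨e, hw'.2⟩))
    · exact .inr ih

/-- One step of the sweep. If exactly the labels of the neighbours of `x` are marked, then giving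
the label `x` to `x` and to all vertices with a marked label is correct. -/
theorem IsLabelling.step (hs : ∀ x y, adj x y → adj y x) {x b : ℕ} {lab lab' : ℕ → ℕ}
    {marked : ℕ → Prop} (hx : x < b) (h : IsLabelling adj (x + 1) b lab)
    (hm : ∀ z ∈ Set.Ico (x + 1) b,
      (marked (lab z) ↔ ∃ w ∈ Set.Ico (x + 1) b, adj x w ∧ lab w = lab z))
    (hlx : lab' x = x)
    (hl : ∀ z ∈ Set.Ico (x + 1) b, (marked (lab z) → lab' z = x) ∧
      (¬ marked (lab z) → lab' z = lab z)) :
    IsLabelling adj x b lab' := by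
  have hlow : ∀ z ∈ Set.Ico x b, x ∈ lowerBounds {y | Conn adj x b z y} :=
    fun z hz y hy => (Conn.mem hy hz).1
  intro z hz
  rcases Nat.eq_or_lt_of_le hz.1 with e | e
  · subst e
    rw [hlx]
    exact ⟨.refl, hlow _ hz⟩
  · have hz' : z ∈ Set.Ico (x + 1) b := ⟨e, hz.2⟩
    by_cases hmz : marked (lab z)
    · rw [(hl z hz').1 hmz]
      obtain ⟨w, hw, hxw, hwz⟩ := (hm z hz').1 hmz
      have hwz := ((h.eq_iff hs hw hz').1 hwz).mono (Nat.le_succ x) le_rfl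
      refine ⟨(hwz.symm hs).trans (.single (hs _ _ hxw) ⟨by have := hw.1; omega, hw.2⟩
        ⟨le_rfl, hx⟩), hlow _ hz⟩
    · rw [(hl z hz').2 hmz]
      refine ⟨Conn.mono (Nat.le_succ x) le_rfl (h z hz').1, fun y hy => ?_⟩
      rcases conn_insert hs hz' hy with hc | ⟨w, hw, hxw, hc⟩
      · exact (h z hz').2 hc
      · exact absurd ((hm z hz').2 ⟨w, hw, hxw, (h.eq_iff hs hw hz').2 hc⟩) hmz

/-- A table of descents that is filled below `3p` from the labellings of `[0, (p + 2) p)` and of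
`[p, (p + 2) p)`, and continued with period `p`, is correct. -/
theorem IsPeriodicBand.isDescent_of_periodic (hG : IsPeriodicBand adj p) (hp : 0 < p) {M : ℕ}
    {lab₀ lab₁ desc : ℕ → ℕ} (h₀ : IsLabelling adj 0 ((p + 2) * p) lab₀)
    (h₁ : IsLabelling adj p ((p + 2) * p) lab₁) (hlow : ∀ q < p + p, desc q = q - lab₀ q)
    (hmid : ∀ q, p + p ≤ q → q < p + p + p → desc q = q - lab₁ q)
    (hhigh : ∀ q, p + p + p ≤ q → q ≤ M → desc q = desc (q - p)) (q : ℕ) (hq : q ≤ M) :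
    IsDescent adj q (desc q) := by
  have hN : p + p + p ≤ (p + 2) * p := by nlinarith
  rcases Nat.lt_or_ge q (p + p) with hq' | hq'
  · rw [hlow q hq']
    exact hG.isDescent_low hp hq' (h₀ q ⟨by omega, by omega⟩)
  · have hper : ∀ k r, p + p ≤ r → r < p + p + p → r + k * p ≤ M →
        desc (r + k * p) = r - lab₁ r := by
      intro k
      induction k with
      | zero =>
        intro r hr hr' _
        rw [Nat.zero_mul, Nat.add_zero, hmid r hr hr']
      | succ k ih =>
        intro r hr hr' hle
        rw [Nat.succ_mul] at hle ⊢
        rw [hhigh _ (by omega) hle, ← ih r hr hr' (by omega), ← Nat.add_assoc,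
          Nat.add_sub_cancel]
    have hmod := Nat.mod_lt (q - (p + p)) hp
    obtain ⟨r, k, hr, hr', rfl⟩ : ∃ r k, p + p ≤ r ∧ r < p + p + p ∧ q = r + k * p :=
      ⟨p + p + (q - (p + p)) % p, (q - (p + p)) / p, by omega, by omega, by
        have := Nat.mod_add_div' (q - (p + p)) p
        omega⟩
    rw [hper k r hr hr' hq]
    exact hG.isDescent_high hp hr hr' (h₁ r ⟨by omega, by omega⟩) k

end Graph

/-! ### Programs over named variables and arrays -/

/-- The scalar variables of the program. -/
inductive Var : Type
  | out | num | per | cur | cnt | lhs | rhs | size | pos | nbr | scan | lbl | tmp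
  deriving DecidableEq

/-- The arrays of the program: the transition table (`both`, `right`, `final`), the states
reached after `x` letters `(1,1)` (`path`), the component labels and their marks (`labels`,
`marks`), and the table of descents (`desc`). -/
inductive Arr : Type
  | both | right | final | path | labels | marks | desc
  deriving DecidableEq

/-- The register that holds a variable. -/
def Var.idx : Var → ℕ
  | out => 0 | num => 1 | per => 2 | cur => 3 | cnt => 4 | lhs => 5 | rhs => 6 | size => 7
  | pos => 8 | nbr => 9 | scan => 10 | lbl => 11 | tmp => 12

/-- The residue modulo `8` of the addresses that hold an array. -/
def Arr.idx : Arr → ℕ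
  | both => 0 | right => 1 | final => 2 | path => 3 | labels => 4 | marks => 5 | desc => 6

theorem Var.idx_inj {x y : Var} : x.idx = y.idx ↔ x = y := by
  cases x <;> cases y <;> simp [Var.idx]

theorem Var.idx_lt (x : Var) : x.idx < 20 := by cases x <;> simp [Var.idx]

theorem Arr.idx_inj {a b : Arr} : a.idx = b.idx ↔ a = b := by
  cases a <;> cases b <;> simp [Arr.idx]

theorem Arr.idx_lt (a : Arr) : a.idx < 8 := by cases a <;> simp [Arr.idx]

/-- The view of a machine configuration as a store of variables and arrays. -/
structure Store where
  var : Var → ℕ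
  arr : Arr → ℕ → ℕ
  input : List ℕ

/-- The configuration `s` represents the store `h`: entry `i` of an array is kept at address
`8 i + r`, where `r` is the residue of the array. Registers from `20` on are scratch space. -/
structure Represents (s : RAM.State) (h : Store) : Prop where
  var : ∀ x, s.reg (Var.idx x) = h.var x
  arr : ∀ a i, s.mem (8 * i + Arr.idx a) = h.arr a i
  input : s.input = h.input

/-- Assignments. -/
inductive Cmd : Type
  /-- `x := k` -/
  | const (x : Var) (k : ℕ)
  /-- `x := y` -/
  | copy (x y : Var)
  /-- `x := y + z` -/
  | add (x y z : Var)
  /-- `x := y - z` -/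
  | sub (x y z : Var)
  /-- `x := y + k` -/
  | addc (x y : Var) (k : ℕ)
  /-- `x := y - k` -/
  | subc (x y : Var) (k : ℕ)
  /-- `x := a[y]` -/
  | load (x : Var) (a : Arr) (y : Var)
  /-- `a[x] := y` -/
  | store (a : Arr) (x y : Var)
  /-- move the next input symbol to `x` -/
  | read (x : Var)

/-- `x := k` -/
def Store.set (h : Store) (x : Var) (k : ℕ) : Store :=
  { h with var := Function.update h.var x k }

/-- `a[i] := k` -/
def Store.setArr (h : Store) (a : Arr) (i k : ℕ) : Store :=
  { h with arr := Function.update h.arr a (Function.update (h.arr a) i k) }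

/-- The effect of an assignment. -/
def Cmd.run : Cmd → Store → Store
  | const x k, h => h.set x k
  | copy x y, h => h.set x (h.var y)
  | add x y z, h => h.set x (h.var y + h.var z)
  | sub x y z, h => h.set x (h.var y - h.var z)
  | addc x y k, h => h.set x (h.var y + k)
  | subc x y k, h => h.set x (h.var y - k)
  | load x a y, h => h.set x (h.arr a (h.var y))
  | store a x y, h => h.setArr a (h.var x) (h.var y)
  | read x, h => { h.set x (h.input.headD 0) with input := h.input.tail }

/-- Machine code that computes in register `20` the address of entry `y` of the array `a`. -/
def addressCode (a : Arr) (y : Var) (P : RAM.Prog) : RAM.Prog :=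
  .seq (.instr (.add 20 y.idx y.idx)) <| .seq (.instr (.add 20 20 20)) <|
    .seq (.instr (.add 20 20 20)) <| .seq (.instr (.const 21 a.idx)) <|
      .seq (.instr (.add 20 20 21)) P

/-- The machine code of an assignment. -/
def Cmd.code : Cmd → RAM.Prog
  | const x k => .instr (.const x.idx k)
  | copy x y => .instr (.copy x.idx y.idx)
  | add x y z => .instr (.add x.idx y.idx z.idx)
  | sub x y z => .instr (.sub x.idx y.idx z.idx)
  | addc x y k => .seq (.instr (.const 20 k)) (.instr (.add x.idx y.idx 20))
  | subc x y k => .seq (.instr (.const 20 k)) (.instr (.sub x.idx y.idx 20))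
  | load x a y => addressCode a y (.instr (.load x.idx 20))
  | store a x y => addressCode a x (.instr (.store 20 y.idx))
  | read x => .instr (.read x.idx)

/-- Started in any configuration that represents `h`, the program `P` halts within `T` steps in a
configuration that represents a store with the property `Q`. -/
def Halts (P : RAM.Prog) (h : Store) (T : ℕ) (Q : Store → Prop) : Prop :=
  ∀ s, Represents s h → ∃ t s' h', RAM.Exec P s t s' ∧ t ≤ T ∧ Represents s' h' ∧ Q h'

theorem Represents.setReg {s : RAM.State} {h : Store} (hr : Represents s h) (x : Var) (k : ℕ) :
    Represents (s.setReg x.idx k) (h.set x k) where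
  var y := by
    by_cases e : y = x
    · subst e; simp [RAM.State.setReg, Store.set]
    · simp [RAM.State.setReg, Store.set, e, Var.idx_inj, hr.var]
  arr := hr.arr
  input := hr.input

theorem Represents.setScratch {s : RAM.State} {h : Store} (hr : Represents s h) (i k : ℕ) :
    Represents (s.setReg (20 + i) k) h where
  var y := by
    have := y.idx_lt
    have e : y.idx ≠ 20 + i := by omega
    simp [RAM.State.setReg, e, hr.var]
  arr := hr.arr
  input := hr.input

theorem Represents.exec_addressCode {s : RAM.State} {h h' : Store} (hr : Represents s h) (a : Arr)
    (y : Var) {P : RAM.Prog}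
    (hP : ∀ s₁, Represents s₁ h → s₁.reg 20 = 8 * h.var y + a.idx →
      ∃ s', RAM.Exec P s₁ 1 s' ∧ Represents s' h') :
    ∃ s', RAM.Exec (addressCode a y P) s 6 s' ∧ Represents s' h' := by
  have h1 := hr.setScratch 0 (s.reg y.idx + s.reg y.idx)
  have h2 := h1.setScratch 0 (4 * s.reg y.idx)
  have h3 := h2.setScratch 0 (8 * s.reg y.idx)
  have h4 := h3.setScratch 1 a.idx
  have h5 := h4.setScratch 0 (8 * s.reg y.idx + a.idx)
  obtain ⟨s', he, hr'⟩ := hP _ h5 (by simp [RAM.State.setReg, hr.var])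
  refine ⟨s', ?_, hr'⟩
  refine .seq (t := 1) (t' := 5) (.instr _ _) <| .seq (t := 1) (t' := 4) (.instr _ _) <|
    .seq (t := 1) (t' := 3) (.instr _ _) <| .seq (t := 1) (t' := 2) (.instr _ _) <|
    .seq (t := 1) (t' := 1) (.instr _ _) ?_
  convert he using 1
  simp only [RAM.Instr.run, RAM.State.setReg]
  congr 1
  funext i
  by_cases e : i = 20
  · subst e; simp; ring
  · by_cases e' : i = 21
    · subst e'; simp
    · simp [e, e']

/-- Six machine steps suffice for an assignment: five for an address and one for the access. -/
theorem Cmd.exec_code (c : Cmd) {s : RAM.State} {h : Store} (hr : Represents s h) :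
    ∃ t s', RAM.Exec c.code s t s' ∧ t ≤ 6 ∧ Represents s' (c.run h) := by
  cases c with
  | const x k => exact ⟨1, _, .instr _ _, by simp, hr.setReg x k⟩
  | copy x y =>
    refine ⟨1, _, .instr _ _, by simp, ?_⟩
    change Represents _ (h.set x (h.var y))
    rw [← hr.var]
    exact hr.setReg x _
  | add x y z =>
    refine ⟨1, _, .instr _ _, by simp, ?_⟩
    change Represents _ (h.set x (h.var y + h.var z))
    rw [← hr.var, ← hr.var]
    exact hr.setReg x _
  | sub x y z =>
    refine ⟨1, _, .instr _ _, by simp, ?_⟩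
    change Represents _ (h.set x (h.var y - h.var z))
    rw [← hr.var, ← hr.var]
    exact hr.setReg x _
  | addc x y k =>
    have h1 := hr.setScratch 0 k
    refine ⟨2, _, .seq (t := 1) (t' := 1) (.instr _ _) (.instr _ _), by simp, ?_⟩
    change Represents _ (h.set x (h.var y + k))
    rw [← h1.var]
    exact h1.setReg x _
  | subc x y k =>
    have h1 := hr.setScratch 0 k
    refine ⟨2, _, .seq (t := 1) (t' := 1) (.instr _ _) (.instr _ _), by simp, ?_⟩
    change Represents _ (h.set x (h.var y - k))
    rw [← h1.var]
    exact h1.setReg x _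
  | load x a y =>
    obtain ⟨s', he, hr'⟩ := hr.exec_addressCode a y (P := .instr (.load x.idx 20))
      (h' := (Cmd.load x a y).run h) (fun s₁ h₁ e => ⟨_, .instr _ _, by
        change Represents _ (h.set x (h.arr a (h.var y)))
        rw [← h₁.arr, ← e]
        exact h₁.setReg x _⟩)
    exact ⟨6, s', he, le_rfl, hr'⟩
  | store a x y =>
    obtain ⟨s', he, hr'⟩ := hr.exec_addressCode a x (P := .instr (.store 20 y.idx))
      (h' := (Cmd.store a x y).run h) (fun s₁ h₁ e => ⟨_, .instr _ _, by
        refine ⟨h₁.var, fun b i => ?_, h₁.input⟩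
        have ha := a.idx_lt
        have hb := b.idx_lt
        simp only [RAM.Instr.run, e, Cmd.run, Store.setArr, h₁.var]
        by_cases hab : b = a
        · subst hab
          by_cases hi : i = h.var x
          · subst hi; simp
          · have : 8 * i + b.idx ≠ 8 * h.var x + b.idx := by omega
            simp [hi, h₁.arr]
        · have hab' : b.idx ≠ a.idx := fun e => hab (Arr.idx_inj.1 e)
          have : 8 * i + b.idx ≠ 8 * h.var x + a.idx := by omega
          simp [this, hab, h₁.arr]⟩)
    exact ⟨6, s', he, le_rfl, hr'⟩
  | read x =>
    refine ⟨1, _, .instr _ _, by simp, ?_⟩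
    have := hr.setReg x (h.input.headD 0)
    rw [← hr.input] at this
    refine ⟨?_, this.arr, by simp [RAM.Instr.run, Cmd.run, hr.input]⟩
    simp only [Cmd.run, ← hr.input]
    exact this.var

/-- Consecutive assignments. The empty sequence is a step without effect: it clears a scratch
register. -/
def block : List Cmd → RAM.Prog
  | [] => .instr (.const 20 0)
  | c :: cs => .seq c.code (block cs)

theorem Halts.mono {P : RAM.Prog} {h : Store} {T T' : ℕ} {Q Q' : Store → Prop}
    (hP : Halts P h T Q) (hT : T ≤ T') (hQ : ∀ h, Q h → Q' h) : Halts P h T' Q' := by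
  intro s hr
  obtain ⟨t, s', h', he, ht, hr', hq⟩ := hP s hr
  exact ⟨t, s', h', he, ht.trans hT, hr', hQ _ hq⟩

theorem Halts.block (cs : List Cmd) {h : Store} {T : ℕ} {Q : Store → Prop}
    (hT : 6 * cs.length + 1 ≤ T) (hQ : Q (cs.foldl (fun h c => c.run h) h)) :
    Halts (block cs) h T Q := by
  induction cs generalizing h T with
  | nil => exact fun s hr => ⟨1, _, h, .instr _ _, by simpa using hT, hr.setScratch 0 0, hQ⟩
  | cons c cs ih =>
    intro s hr
    obtain ⟨t, s', he, ht, hr'⟩ := c.exec_code hr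
    obtain ⟨t', s'', h', he', ht', hr'', hq⟩ := ih (T := 6 * cs.length + 1) le_rfl hQ s' hr'
    simp only [List.length_cons] at hT
    exact ⟨t + t', s'', h', .seq he he', by omega, hr'', hq⟩

theorem Halts.seq {P P' : RAM.Prog} {h : Store} {T T₁ T₂ : ℕ} {R Q : Store → Prop}
    (hP : Halts P h T₁ R) (hP' : ∀ h', R h' → Halts P' h' T₂ Q) (hT : T₁ + T₂ ≤ T) :
    Halts (.seq P P') h T Q := by
  intro s hr
  obtain ⟨t, s', h', he, ht, hr', hq⟩ := hP s hr
  obtain ⟨t', s'', h'', he', ht', hr'', hq'⟩ := hP' h' hq s' hr'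
  exact ⟨t + t', s'', h'', .seq he he', by omega, hr'', hq'⟩

theorem Halts.cond {x : Var} {P P' : RAM.Prog} {h : Store} {T T' : ℕ} {Q : Store → Prop}
    (hP : h.var x ≠ 0 → Halts P h T Q) (hP' : h.var x = 0 → Halts P' h T Q) (hT : T + 1 ≤ T') :
    Halts (.cond x.idx P P') h T' Q := by
  intro s hr
  by_cases e : h.var x = 0
  · obtain ⟨t, s', h', he, ht, hr', hq⟩ := hP' e s hr
    exact ⟨1 + t, s', h', .condFalse (by rw [hr.var, e]) he, by omega, hr', hq⟩
  · obtain ⟨t, s', h', he, ht, hr', hq⟩ := hP e s hr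
    exact ⟨1 + t, s', h', .condTrue (by rwa [hr.var]) he, by omega, hr', hq⟩

/-- The rule for loops: `I k` is the invariant that leaves at most `k` iterations. -/
theorem Halts.loop {x : Var} {P : RAM.Prog} (I : ℕ → Store → Prop) (T : ℕ) {k T' : ℕ} {h : Store}
    {Q : Store → Prop} (hI : I k h)
    (hstep : ∀ k h, I k h → h.var x ≠ 0 → ∃ k', k = k' + 1 ∧ Halts P h T (I k'))
    (hQ : ∀ k h, I k h → h.var x = 0 → Q h) (hT : k * (T + 1) + 1 ≤ T') :
    Halts (.loop x.idx P) h T' Q := by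
  induction k using Nat.strong_induction_on generalizing h T' with
  | _ k ih =>
  intro s hr
  by_cases e : h.var x = 0
  · exact ⟨1, s, h, .loopExit (by rw [hr.var, e]), by omega, hr, hQ k h hI e⟩
  · obtain ⟨k', rfl, hP⟩ := hstep k h hI e
    obtain ⟨t, s', h', he, ht, hr', hI'⟩ := hP s hr
    obtain ⟨t', s'', h'', he', ht', hr'', hq⟩ :=
      ih k' (by omega) hI' (T' := k' * (T + 1) + 1) le_rfl s' hr'
    refine ⟨1 + t + t', s'', h'', .loopStep (by rwa [hr.var]) he he', ?_, hr'', hq⟩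
    have : (k' + 1) * (T + 1) = k' * (T + 1) + (T + 1) := by ring
    omega

/-- The rule for counting loops: the body decrements the loop variable. -/
theorem Halts.for {x : Var} {P : RAM.Prog} (I : ℕ → Store → Prop) (T : ℕ) {k T' : ℕ} {h : Store}
    (hx : h.var x = k) (hI : I k h)
    (hstep : ∀ k h, h.var x = k + 1 → I (k + 1) h →
      Halts P h T fun h' => h'.var x = k ∧ I k h')
    (hT : k * (T + 1) + 1 ≤ T') :
    Halts (.loop x.idx P) h T' (I 0) := by
  refine Halts.loop (fun k h => h.var x = k ∧ I k h) T ⟨hx, hI⟩ ?_ ?_ hT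
  · rintro k h ⟨hx, hI⟩ h0
    obtain ⟨k, rfl⟩ := Nat.exists_eq_succ_of_ne_zero (hx ▸ h0)
    exact ⟨k, rfl, hstep k h hx hI⟩
  · rintro k h ⟨hx, hI⟩ h0
    obtain rfl : k = 0 := by omega
    exact hI

/-! ### Frame conditions -/

/-- The stores `h` and `h'` agree except for the variables `xs`, the arrays `as` and the input. -/
structure Agree (xs : List Var) (as : List Arr) (h h' : Store) : Prop where
  var : ∀ x, x ∉ xs → h'.var x = h.var x
  arr : ∀ a, a ∉ as → h'.arr a = h.arr a

/-- The target of an assignment belongs to the variables `xs` or to the arrays `as`. -/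
def Cmd.targetsIn (xs : List Var) (as : List Arr) : Cmd → Bool
  | const x _ | copy x _ | add x _ _ | sub x _ _ | addc x _ _ | subc x _ _ | load x _ _ | read x =>
    decide (x ∈ xs)
  | store a _ _ => decide (a ∈ as)

theorem Agree.refl (xs : List Var) (as : List Arr) (h : Store) : Agree xs as h h :=
  ⟨fun _ _ => rfl, fun _ _ => rfl⟩

theorem Agree.trans {xs ys zs : List Var} {as bs cs : List Arr} {h h' h'' : Store}
    (H : Agree xs as h h') (H' : Agree ys bs h' h'') (hx : xs ⊆ zs) (hy : ys ⊆ zs) (ha : as ⊆ cs)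
    (hb : bs ⊆ cs) : Agree zs cs h h'' :=
  ⟨fun x h => (H'.var x fun e => h (hy e)).trans (H.var x fun e => h (hx e)),
    fun a h => (H'.arr a fun e => h (hb e)).trans (H.arr a fun e => h (ha e))⟩

theorem Agree.set {xs : List Var} {as : List Arr} {h h' : Store} (H : Agree xs as h h') {x : Var}
    (hx : x ∈ xs) (k : ℕ) : Agree xs as h (h'.set x k) :=
  ⟨fun y hy => by
    have e : y ≠ x := fun e => hy (e ▸ hx)
    simp [Store.set, e, H.var y hy], H.arr⟩

theorem Agree.run {xs : List Var} {as : List Arr} {h h' : Store} (H : Agree xs as h h') {c : Cmd}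
    (hc : c.targetsIn xs as = true) : Agree xs as h (c.run h') := by
  cases c <;> simp only [Cmd.targetsIn, decide_eq_true_eq] at hc
  case store a x y =>
    exact ⟨H.var, fun b hb => by
      have e : b ≠ a := fun e => hb (e ▸ hc)
      simp [Cmd.run, Store.setArr, e, H.arr b hb]⟩
  all_goals first
    | exact H.set hc _
    | exact ⟨(H.set hc _).var, (H.set hc 0).arr⟩

theorem Agree.block {xs : List Var} {as : List Arr} {h h' : Store} (H : Agree xs as h h')
    {cs : List Cmd} (hc : cs.all (Cmd.targetsIn xs as) = true) :
    Agree xs as h (cs.foldl (fun h c => c.run h) h') := by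
  induction cs generalizing h' with
  | nil => exact H
  | cons c cs ih =>
    simp only [List.all_cons, Bool.and_eq_true] at hc
    exact ih (H.run hc.1) hc.2

/-! ### The parts of the program -/

/-- The rows of the transition table are stored from index `1` on, so that an entry of the table,
which is `0` or a state plus one, is itself an index. -/
def readTable : RAM.Prog :=
  .seq (block [.read .num, .read .cur, .addc .cur .cur 1, .copy .cnt .num]) <|
    .loop Var.cnt.idx (block [.addc .pos .pos 1, .read .lbl, .store .both .pos .lbl, .read .lbl,
      .read .lbl, .store .right .pos .lbl, .read .lbl, .store .final .pos .lbl,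
      .subc .cnt .cnt 1])

/-- The loop constant is the length of the `(⋄,1)`-tail of the initial state. -/
def findPeriod : RAM.Prog :=
  .seq (block [.load .nbr .right .cur]) <|
    .loop Var.nbr.idx (block [.addc .per .per 1, .load .nbr .right .nbr])

/-- Read a word and add its length to the variable `w`. -/
def readWord (w : Var) : RAM.Prog :=
  .seq (block [.read .cnt]) <| .loop Var.cnt.idx (block [.addc w w 1, .read .cnt])

/-- The number of vertices that are swept is `(p + 2) p`. -/
def computeSize : RAM.Prog :=
  .seq (block [.addc .cnt .per 2, .const .size 0]) <|
    .loop Var.cnt.idx (block [.add .size .size .per, .subc .cnt .cnt 1])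

/-- Store the states that are reached after `0, 1, 2, …` letters `(1,1)`. -/
def computePath : RAM.Prog :=
  .seq (block [.copy .cnt .size, .const .pos 0]) <|
    .loop Var.cnt.idx (block [.store .path .pos .cur, .load .cur .both .cur, .addc .pos .pos 1,
      .subc .cnt .cnt 1])

/-- Walk along a `(⋄,1)`-tail and mark the labels of the neighbours that it accepts. -/
def markNeighbours : RAM.Prog :=
  .seq (block [.load .cur .path .pos, .load .cur .right .cur, .addc .nbr .pos 1]) <|
    .loop Var.cur.idx <|
      .seq (block [.sub .tmp .size .nbr, .load .lbl .final .cur]) <|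
        .seq (.cond Var.tmp.idx
          (.cond Var.lbl.idx (block [.load .lbl .labels .nbr, .const .tmp 1,
            .store .marks .lbl .tmp]) (block [])) (block []))
          (block [.load .cur .right .cur, .addc .nbr .nbr 1])

/-- Give the label `pos` to all larger vertices with a marked label. -/
def relabel : RAM.Prog :=
  .seq (block [.addc .scan .pos 1, .sub .tmp .size .scan]) <|
    .loop Var.tmp.idx <|
      .seq (block [.load .lbl .labels .scan, .load .lbl .marks .lbl]) <|
        .seq (.cond Var.lbl.idx (block [.store .labels .scan .pos]) (block []))
          (block [.addc .scan .scan 1, .sub .tmp .size .scan])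

/-- Extend the labelling by `cnt` vertices below `pos`, in decreasing order. -/
def sweep : RAM.Prog :=
  .loop Var.cnt.idx <| .seq (block [.subc .pos .pos 1]) <| .seq markNeighbours <|
    .seq relabel (block [.store .labels .pos .pos, .subc .cnt .cnt 1])

/-- Store the descents of `cnt` vertices from `scan` on, as given by their labels. -/
def fillDescents : RAM.Prog :=
  .loop Var.cnt.idx (block [.load .lbl .labels .scan, .sub .lbl .scan .lbl,
    .store .desc .scan .lbl, .addc .scan .scan 1, .subc .cnt .cnt 1])

/-- Continue the table of descents periodically to `cnt` vertices from `scan` on. -/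
def extendDescents : RAM.Prog :=
  .loop Var.cnt.idx (block [.sub .lbl .scan .per, .load .lbl .desc .lbl,
    .store .desc .scan .lbl, .addc .scan .scan 1, .subc .cnt .cnt 1])

/-- Replace the vertex `w` by the least vertex of its component. -/
def descend (w : Var) : RAM.Prog :=
  .seq (block [.load .cnt .desc w]) <| .loop Var.cnt.idx (block [.sub w w .cnt, .load .cnt .desc w])

/-- Test the equality of the two vertices. -/
def testEqual : RAM.Prog :=
  block [.sub .pos .lhs .rhs, .sub .nbr .rhs .lhs, .add .pos .pos .nbr, .const .out 1,
    .sub .out .out .pos]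

/-! ### Correctness and running time of the parts -/

section Verification

variable {adj : ℕ → ℕ → Prop} {p start : ℕ} {B R F : ℕ → ℕ}

/-- The transition table, given by the targets `B` of `(1,1)`, the targets `R` of `(⋄,1)` and the
final states `F`, describes the graph `adj`: after `x` letters `(1,1)` exactly `p` letters `(⋄,1)`
can be read, and the `k`-th of them leads to a final state if and only if `x` and `x + k` are
adjacent. -/
structure IsTable (adj : ℕ → ℕ → Prop) (p start : ℕ) (B R F : ℕ → ℕ) : Prop where
  ne_zero : ∀ x, ∀ k < p, R^[k + 1] (B^[x] start) ≠ 0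
  eq_zero : ∀ x, R^[p + 1] (B^[x] start) = 0
  final : ∀ x, ∀ k < p, (F (R^[k + 1] (B^[x] start)) ≠ 0 ↔ adj x (x + (k + 1)))

theorem halts_readTable {n s : ℕ} (b l r f : Fin n → ℕ) (rest : List ℕ) {h : Store}
    (hin : h.input = n :: s :: (List.finRange n).flatMap (fun i => [b i, l i, r i, f i]) ++ rest)
    (hpos : h.var .pos = 0) :
    Halts readTable h (56 * n + 26) fun h' =>
      Agree [.num, .cur, .cnt, .pos, .lbl] [.both, .right, .final] h h' ∧ h'.input = rest ∧
      h'.var .cur = s + 1 ∧ ∀ i : Fin n, h'.arr .both (i + 1) = b i ∧ h'.arr .right (i + 1) = r i ∧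
        h'.arr .final (i + 1) = f i := by
  refine Halts.seq (Halts.block (T := 25) _ (by simp) rfl) (T₂ := 56 * n + 1) ?_ (by omega)
  rintro h' rfl
  refine Halts.mono (Halts.for (k := n) (fun k h' => k ≤ n ∧
    Agree [.num, .cur, .cnt, .pos, .lbl] [.both, .right, .final] h h' ∧
    h'.input = ((List.finRange n).drop (n - k)).flatMap (fun i => [b i, l i, r i, f i]) ++ rest ∧
    h'.var .cur = s + 1 ∧ h'.var .pos = n - k ∧
    ∀ i : Fin n, i < n - k → h'.arr .both (i + 1) = b i ∧ h'.arr .right (i + 1) = r i ∧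
        h'.arr .final (i + 1) = f i) 55 ?_ ⟨le_rfl, (Agree.refl _ _ _).block (by decide), ?_⟩ ?_
        le_rfl) (by omega) ?_
  · simp [Cmd.run, Store.set, hin]
  · simp [Cmd.run, Store.set, hin, hpos]
  · rintro k h' hk ⟨hkn, hA, hin', hcur, hpos', hT⟩
    have hlt : n - (k + 1) < n := by omega
    have e1 : n - (k + 1) + 1 = n - k := by omega
    have hd : (List.finRange n).drop (n - (k + 1)) =
        ⟨n - (k + 1), hlt⟩ :: (List.finRange n).drop (n - k) := by
      rw [List.drop_eq_getElem_cons (by simpa using hlt), e1]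
      simp
    rw [hd] at hin'
    simp only [List.flatMap_cons, List.cons_append, List.nil_append] at hin'
    refine Halts.block _ (by simp) ⟨?_, by omega, hA.block (by decide), ?_, ?_, ?_, ?_⟩
    · simp [Cmd.run, Store.set, Store.setArr, hk]
    · simp [Cmd.run, Store.set, Store.setArr, hin']
    · simp [Cmd.run, Store.set, Store.setArr, hcur]
    · simp [Cmd.run, Store.set, Store.setArr, hpos']
      omega
    · intro i hi
      simp only [List.foldl, Cmd.run, Store.set, Store.setArr, Function.update_apply, hin', hpos',
        e1]
      by_cases e : (i : ℕ) + 1 = n - k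
      · have e' : i = ⟨n - (k + 1), hlt⟩ := Fin.ext (by simp; omega)
        simp [e, ← e']
      · simpa [e] using hT i (by omega)
  · rintro h' ⟨-, hA, hin', hcur, -, hT⟩
    refine ⟨hA, ?_, hcur, fun i => hT i (by simp)⟩
    rw [hin', List.drop_of_length_le (by simp)]
    simp

theorem halts_findPeriod (hT : IsTable adj p start B R F) {h : Store} (hR : h.arr .right = R)
    (hcur : h.var .cur = start) (hper : h.var .per = 0) :
    Halts findPeriod h (14 * p + 8) fun h' =>
      Agree [.nbr, .per] [] h h' ∧ h'.input = h.input ∧ h'.var .per = p := by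
  refine Halts.seq (Halts.block (T := 7) _ (by simp) rfl) (T₂ := 14 * p + 1) ?_ (by omega)
  rintro h' rfl
  refine Halts.loop (k := p) (fun k h' => k ≤ p ∧ Agree [.nbr, .per] [] h h' ∧
    h'.input = h.input ∧ h'.var .per = p - k ∧ h'.var .nbr = R^[p - k + 1] start) 13
    ⟨le_rfl, (Agree.refl _ _ _).block (by decide), ?_, ?_, ?_⟩ ?_ ?_ (by omega)
  · simp [Cmd.run, Store.set]
  · simp [Cmd.run, Store.set, hper]
  · simp [Cmd.run, Store.set, hcur, hR]
  · rintro k h' ⟨hk, hA, hin, hper', hnbr⟩ h0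
    rcases k with _ | k
    · exact absurd (hnbr.trans (hT.eq_zero 0)) h0
    refine ⟨k, rfl, Halts.block _ (by simp) ⟨by omega, hA.block (by decide), ?_, ?_, ?_⟩⟩
    · simpa [Cmd.run, Store.set] using hin
    · simp [Cmd.run, Store.set, hper']
      omega
    · have e : p - k + 1 = (p - (k + 1) + 1) + 1 := by omega
      simp only [List.foldl, Cmd.run, Store.set, Function.update_apply, hnbr,
        hA.arr .right (by simp), hR, e, Function.iterate_succ_apply']
      simp
  · rintro k h' ⟨hk, hA, hin, hper', hnbr⟩ h0
    refine ⟨hA, hin, ?_⟩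
    rcases k with _ | k
    · exact hper'
    · exact absurd (hnbr.symm.trans h0) (hT.ne_zero 0 (p - (k + 1)) (by omega))

theorem halts_readWord {w : Var} (hw : w ≠ .cnt) (u : List Unit) (rest : List ℕ) {h : Store}
    (hin : h.input = encodeWord u ++ rest) (hw0 : h.var w = 0) :
    Halts (readWord w) h (14 * u.length + 8) fun h' =>
      Agree [w, .cnt] [] h h' ∧ h'.input = rest ∧ h'.var w = u.length := by
  have hcode : ∀ k, encodeWord (List.replicate (k + 1) ()) =
      1 :: encodeWord (List.replicate k ()) :=
    fun k => by simp [encodeWord, List.replicate_succ]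
  have hu : u = List.replicate u.length () := List.eq_replicate_iff.2 ⟨rfl, fun _ _ => rfl⟩
  generalize hm : u.length = m at hu
  subst hu
  refine Halts.seq (Halts.block (T := 7) _ (by simp) rfl) (T₂ := 14 * m + 1) ?_ (by omega)
  rintro h' rfl
  refine Halts.loop (k := m) (fun k h' => k ≤ m ∧ Agree [w, .cnt] [] h h' ∧
    h'.var .cnt :: h'.input = encodeWord (List.replicate k ()) ++ rest ∧
    h'.var w + k = m) 13 ⟨le_rfl, ?_, ?_, ?_⟩ ?_ ?_ (by omega)
  · exact (Agree.refl _ _ _).block (cs := [.read .cnt]) (by simp [Cmd.targetsIn])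
  · rw [← hin]
    rcases m with _ | m
    · simp [Cmd.run, Store.set, hin, encodeWord]
    · simp [Cmd.run, Store.set, hin, hcode]
  · simp [Cmd.run, Store.set, hw, hw0]
  · rintro k h' ⟨hk, hA, hin', hw'⟩ h0
    rcases k with _ | k
    · simp [encodeWord] at hin'
      exact absurd hin'.1 h0
    rw [hcode, List.cons_append] at hin'
    obtain ⟨-, hin'⟩ := List.cons.inj hin'
    refine ⟨k, rfl, Halts.block _ (by simp) ⟨by omega, ?_, ?_, ?_⟩⟩
    · exact hA.block (cs := [.addc w w 1, .read .cnt]) (by simp [Cmd.targetsIn])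
    · rw [← hin']
      rcases k with _ | k
      · simp [Cmd.run, Store.set, hin', encodeWord]
      · simp [Cmd.run, Store.set, hin', hcode]
    · simp [Cmd.run, Store.set, hw]
      omega
  · rintro k h' ⟨hk, hA, hin', hw'⟩ h0
    rcases k with _ | k
    · simp [encodeWord] at hin'
      exact ⟨hA, hin'.2, hw'⟩
    · rw [hcode, List.cons_append, h0] at hin'
      simp at hin'

theorem halts_computeSize {h : Store} (hper : h.var .per = p) :
    Halts computeSize h (14 * (p + 2) + 14) fun h' =>
      Agree [.cnt, .size] [] h h' ∧ h'.var .size = (p + 2) * p := by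
  refine Halts.seq (Halts.block (T := 13) _ (by simp) rfl) (T₂ := 14 * (p + 2) + 1) ?_ (by omega)
  rintro h' rfl
  refine Halts.mono (Halts.for (k := p + 2) (fun k h' => Agree [.cnt, .size] [] h h' ∧
    h'.var .size + k * p = (p + 2) * p) 13 ?_ ⟨(Agree.refl _ _ _).block (by decide), ?_⟩ ?_
    le_rfl) (by omega) ?_
  · simp [Cmd.run, Store.set, hper]
  · simp [Cmd.run, Store.set]
  · rintro k h' hk ⟨hA, hs⟩
    refine Halts.block _ (by simp) ⟨?_, hA.block (by decide), ?_⟩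
    · simp [Cmd.run, Store.set, hk]
    · rw [← hs]
      simp [Cmd.run, Store.set, hA.var, hper]
      ring
  · rintro h' ⟨hA, hs⟩
    exact ⟨hA, by simpa using hs⟩

theorem halts_computePath {N : ℕ} {h : Store} (hB : h.arr .both = B) (hcur : h.var .cur = start)
    (hN : h.var .size = N) :
    Halts computePath h (26 * N + 14) fun h' =>
      Agree [.cnt, .pos, .cur] [.path] h h' ∧ h'.var .pos = N ∧
        ∀ x < N, h'.arr .path x = B^[x] start := by
  refine Halts.seq (Halts.block (T := 13) _ (by simp) rfl) (T₂ := 26 * N + 1) ?_ (by omega)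
  rintro h' rfl
  refine Halts.mono (Halts.for (k := N) (fun k h' => Agree [.cnt, .pos, .cur] [.path] h h' ∧
    h'.var .pos + k = N ∧ h'.var .cur = B^[h'.var .pos] start ∧
    ∀ x < h'.var .pos, h'.arr .path x = B^[x] start) 25 ?_
    ⟨(Agree.refl _ _ _).block (by decide), ?_⟩ ?_ le_rfl) (by omega) ?_
  · simp [Cmd.run, Store.set, hN]
  · simp [Cmd.run, Store.set, hcur]
  · rintro k h' hk ⟨hA, hpos, hcur', hpath⟩
    refine Halts.block _ (by simp) ⟨?_, hA.block (by decide), ?_, ?_, ?_⟩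
    · simp [Cmd.run, Store.set, Store.setArr, hk]
    · simp [Cmd.run, Store.set, Store.setArr]
      omega
    · simp [Cmd.run, Store.set, Store.setArr, hA.arr, hB, hcur',
        ← Function.iterate_succ_apply' B]
    · intro x hx
      simp [Cmd.run, Store.set, Store.setArr, Function.update_apply] at hx ⊢
      split_ifs with e
      · rw [e, hcur']
      · exact hpath x (by omega)
  · rintro h' ⟨hA, hpos, -, hpath⟩
    simp only [add_zero] at hpos
    exact ⟨hA, hpos, fun x hx => hpath x (hpos ▸ hx)⟩

/-- The mark of a label is clear if the label is in use on `[a, b)` or may still come into use. -/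
def MarksClear (a b : ℕ) (lab mark : ℕ → ℕ) : Prop :=
  (∀ c < a, mark c = 0) ∧ ∀ z ∈ Set.Ico a b, mark (lab z) = 0

/-- Only labels of neighbours inside the swept interval `[x + 1, N)` are marked; that the whole tail
is read is enough because edges have length at most `p`. -/
theorem halts_markNeighbours (hG : IsPeriodicBand adj p) (hT : IsTable adj p start B R F) {N x : ℕ}
    {h : Store} (hR : h.arr .right = R) (hF : h.arr .final = F)
    (hP : h.arr .path x = B^[x] start) (hN : h.var .size = N) (hx : h.var .pos = x) :
    Halts markNeighbours h (50 * p + 20) fun h' =>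
      Agree [.cur, .nbr, .lbl, .tmp] [.marks] h h' ∧
      ∀ c, h'.arr .marks c ≠ 0 ↔ h.arr .marks c ≠ 0 ∨
        ∃ w ∈ Set.Ico (x + 1) N, adj x w ∧ h.arr .labels w = c := by
  refine Halts.seq (Halts.block (T := 19) _ (by simp) rfl) (T₂ := 50 * p + 1) ?_ (by omega)
  rintro h' rfl
  refine Halts.loop (k := p) (fun k h' => k ≤ p ∧ Agree [.cur, .nbr, .lbl, .tmp] [.marks] h h' ∧
    h'.var .cur = R^[p - k + 1] (B^[x] start) ∧ h'.var .nbr = x + (p - k + 1) ∧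
    ∀ c, h'.arr .marks c ≠ 0 ↔ h.arr .marks c ≠ 0 ∨
      ∃ w ∈ Set.Ico (x + 1) N, w < x + (p - k + 1) ∧ adj x w ∧ h.arr .labels w = c) 48
    ⟨le_rfl, (Agree.refl _ _ _).block (by decide), ?_, ?_, ?_⟩ ?_ ?_ (by omega)
  · simp [Cmd.run, Store.set, hx, hP, hR]
  · simp [Cmd.run, Store.set, hx]
  · intro c
    simp only [List.foldl, Cmd.run, Store.set]
    refine ⟨.inl, ?_⟩
    rintro (hc | ⟨w, ⟨hw, -⟩, hw', -⟩)
    · exact hc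
    · omega
  · rintro k h₁ ⟨hk, hA, hcur, hnbr, hm⟩ h0
    rcases k with _ | k
    · exact absurd (hcur.trans (hT.eq_zero x)) h0
    have e : p - k + 1 = (p - (k + 1) + 1) + 1 := by omega
    have hadj := hT.final x (p - (k + 1)) (by omega)
    refine ⟨k, rfl, Halts.seq (Halts.block (T := 13) _ (by simp) rfl) (T₂ := 35) ?_ (by omega)⟩
    rintro h₂ rfl
    -- After the test, the mark of the label of the current vertex has been set if needed.
    refine Halts.seq (T₁ := 21) (T₂ := 13)
      (R := fun h₃ => Agree [.lbl, .tmp] [.marks] h₁ h₃ ∧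
        ∀ c, h₃.arr .marks c ≠ 0 ↔ h₁.arr .marks c ≠ 0 ∨
          (h₁.var .nbr < N ∧ adj x (h₁.var .nbr) ∧ h.arr .labels (h₁.var .nbr) = c))
      ?_ ?_ (by omega)
    · have hA₂ : Agree [.lbl, .tmp] [.marks] h₁ (([Cmd.sub .tmp .size .nbr,
          .load .lbl .final .cur]).foldl (fun h c => c.run h) h₁) :=
        (Agree.refl _ _ _).block (by decide)
      have hN₁ : h₁.var .size = N := (hA.var _ (by simp)).trans hN
      have hF₁ : h₁.arr .final = F := (hA.arr _ (by simp)).trans hF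
      have hL₁ : h₁.arr .labels = h.arr .labels := hA.arr _ (by simp)
      refine Halts.cond (T := 20) (fun h1 => ?_) (fun h1 => ?_) (by omega)
      · refine Halts.cond (T := 19) (fun h2 => ?_) (fun h2 => ?_) (by omega)
        · refine Halts.block _ (by simp) ⟨hA₂.block (by decide), fun c => ?_⟩
          simp [Cmd.run, Store.set, hN₁, hF₁] at h1 h2
          rw [hcur] at h2
          have h2' : adj x (h₁.var .nbr) := by rwa [hnbr, ← hadj]
          simp [Cmd.run, Store.set, Store.setArr, hL₁, Function.update_apply]
          have : h₁.var .nbr < N := by omega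
          simp only [this, h2', true_and]
          by_cases hc : h.arr .labels (h₁.var .nbr) = c
          · simp [hc]
          · simp [hc, Ne.symm hc]
        · refine Halts.block _ (by simp) ⟨hA₂, fun c => ?_⟩
          simp [Cmd.run, Store.set, hF₁] at h2
          rw [hcur] at h2
          have h2' : ¬ adj x (h₁.var .nbr) := by
            rw [hnbr, ← hadj]
            exact not_not_intro h2
          simp [Cmd.run, Store.set, h2']
      · refine Halts.block _ (by simp) ⟨hA₂, fun c => ?_⟩
        simp [Cmd.run, Store.set, hN₁] at h1
        have : ¬ h₁.var .nbr < N := by omega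
        simp [Cmd.run, Store.set, this]
    · rintro h₃ ⟨hA₃, hm₃⟩
      have hA' := hA.trans (zs := [.cur, .nbr, .lbl, .tmp]) (cs := [.marks]) hA₃ (by simp)
        (by simp) (by simp) (by simp)
      refine Halts.block _ (by simp) ⟨by omega, hA'.block (by decide), ?_, ?_, fun c => ?_⟩
      · simp [Cmd.run, Store.set, hA₃.var, hcur, hA'.arr, hR, e,
          Function.iterate_succ_apply']
      · simp [Cmd.run, Store.set, hA₃.var, hnbr]
        omega
      · change h₃.arr .marks c ≠ 0 ↔ _
        rw [hm₃, hm, or_assoc, hnbr]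
        refine or_congr_right ⟨?_, ?_⟩
        · rintro (⟨w, hw, hw', hw''⟩ | ⟨h1, h2⟩)
          · exact ⟨w, hw, by omega, hw''⟩
          · exact ⟨_, ⟨by omega, h1⟩, by omega, h2⟩
        · rintro ⟨w, hw, hw', hw''⟩
          by_cases e' : w < x + (p - (k + 1) + 1)
          · exact .inl ⟨w, hw, e', hw''⟩
          · obtain rfl : w = x + (p - (k + 1) + 1) := by omega
            exact .inr ⟨hw.2, hw''⟩
  · rintro k h' ⟨hk, hA, hcur, -, hm⟩ h0
    rcases k with _ | k
    · refine ⟨hA, fun c => (hm c).trans (or_congr_right ?_)⟩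
      constructor
      · rintro ⟨w, hw, -, hw'⟩
        exact ⟨w, hw, hw'⟩
      · rintro ⟨w, hw, hw'⟩
        have := hG.band _ _ hw'.1
        exact ⟨w, hw, by omega, hw'⟩
    · exact absurd (hcur.symm.trans h0) (hT.ne_zero x (p - (k + 1)) (by omega))

theorem halts_relabel {N x : ℕ} {h : Store} (hN : h.var .size = N) (hx : h.var .pos = x)
    (hxN : x < N) :
    Halts relabel h (36 * N + 14) fun h' => Agree [.scan, .tmp, .lbl] [.labels] h h' ∧
      ∀ z ∈ Set.Ico (x + 1) N, h'.arr .labels z =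
        if h.arr .marks (h.arr .labels z) ≠ 0 then x else h.arr .labels z := by
  refine Halts.seq (Halts.block (T := 13) _ (by simp) rfl) (T₂ := 36 * N + 1) ?_ (by omega)
  rintro h' rfl
  refine Halts.mono (Halts.for (k := N - (x + 1)) (fun k h' =>
    Agree [.scan, .tmp, .lbl] [.labels] h h' ∧ h'.var .scan + k = N ∧ x < h'.var .scan ∧
    ∀ z ∈ Set.Ico (x + 1) N, h'.arr .labels z =
      if z < h'.var .scan ∧ h.arr .marks (h.arr .labels z) ≠ 0 then x else h.arr .labels z) 35 ?_
    ⟨(Agree.refl _ _ _).block (by decide), ?_, ?_, ?_⟩ ?_ le_rfl) ?_ ?_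
  · simp [Cmd.run, Store.set, hN, hx]
  · simp [Cmd.run, Store.set, hx]
    omega
  · simp [Cmd.run, Store.set, hx]
  · rintro z ⟨hz, -⟩
    have : ¬ z < x + 1 := by omega
    simp [Cmd.run, Store.set, hx, this]
  · rintro k h₁ hk ⟨hA, hs, hxs, hl⟩
    have hM₁ : h₁.arr .marks = h.arr .marks := hA.arr _ (by simp)
    have hx₁ : h₁.var .pos = x := (hA.var _ (by simp)).trans hx
    have hN₁ : h₁.var .size = N := (hA.var _ (by simp)).trans hN
    have hls := hl (h₁.var .scan) ⟨by omega, by omega⟩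
    simp only [lt_irrefl, false_and, if_false] at hls
    refine Halts.seq (Halts.block (T := 13) _ (by simp) rfl) (T₂ := 22) ?_ (by omega)
    rintro h₂ rfl
    have hA₂ : Agree [.lbl] [.labels] h₁ (([Cmd.load .lbl .labels .scan,
        .load .lbl .marks .lbl]).foldl (fun h c => c.run h) h₁) :=
      (Agree.refl _ _ _).block (by decide)
    refine Halts.seq (T₁ := 8) (T₂ := 13)
      (R := fun h₃ => Agree [.lbl] [.labels] h₁ h₃ ∧ ∀ z, h₃.arr .labels z =
        if z = h₁.var .scan ∧ h.arr .marks (h.arr .labels z) ≠ 0 then x else h₁.arr .labels z)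
      ?_ ?_ (by omega)
    · refine Halts.cond (T := 7) (fun h1 => ?_) (fun h1 => ?_) (by omega)
      · refine Halts.block _ (by simp) ⟨hA₂.block (by decide), fun z => ?_⟩
        simp [Cmd.run, Store.set, hls, hM₁] at h1
        by_cases e : z = h₁.var .scan
        · subst e
          simp [Cmd.run, Store.set, Store.setArr, hx₁, h1]
        · simp [Cmd.run, Store.set, Store.setArr, e]
      · refine Halts.block _ (by simp) ⟨hA₂, fun z => ?_⟩
        simp [Cmd.run, Store.set, hls, hM₁] at h1
        by_cases e : z = h₁.var .scan
        · subst e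
          simp [Cmd.run, Store.set, h1]
        · simp [Cmd.run, Store.set, e]
    · rintro h₃ ⟨hA₃, hl₃⟩
      have hA' := hA.trans (zs := [.scan, .tmp, .lbl]) (cs := [.labels]) hA₃ (by simp)
        (by simp) (by simp) (by simp)
      refine Halts.block _ (by simp) ⟨?_, hA'.block (by decide), ?_, ?_, fun z hz => ?_⟩
      · simp [Cmd.run, Store.set, hA₃.var, hN₁]
        omega
      · simp [Cmd.run, Store.set, hA₃.var]
        omega
      · simp [Cmd.run, Store.set, hA₃.var]
        omega
      · change h₃.arr .labels z = _
        rw [hl₃, hl z hz]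
        simp only [List.foldl, Cmd.run, Store.set]
        simp only [hA₃.var .scan (by simp), Function.update_self, ne_eq, reduceCtorEq,
          not_false_eq_true, Function.update_of_ne]
        by_cases hm : h.arr .marks (h.arr .labels z) = 0
        · simp [hm]
        · simp only [hm, not_false_eq_true, and_true]
          split_ifs <;> first | rfl | omega
  · have : (N - (x + 1)) * 36 ≤ N * 36 := Nat.mul_le_mul_right _ (by omega)
    omega
  · rintro h' ⟨hA, hs, -, hl⟩
    refine ⟨hA, fun z hz => ?_⟩
    rw [hl z hz]
    have : z < h'.var .scan := by have := hz.2; omega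
    simp [this]

/-- The marks never have to be erased: a marked label is replaced by `x` everywhere, and labels that
are introduced later are smaller than `x`. -/
theorem halts_sweep (hG : IsPeriodicBand adj p) (hT : IsTable adj p start B R F) {N a k : ℕ}
    {h : Store} (hR : h.arr .right = R) (hF : h.arr .final = F)
    (hP : ∀ x < N, h.arr .path x = B^[x] start) (hN : h.var .size = N)
    (hpos : h.var .pos = a + k) (hcnt : h.var .cnt = k) (hk : a + k ≤ N)
    (hlab : IsLabelling adj (a + k) N (h.arr .labels))
    (hmark : MarksClear (a + k) N (h.arr .labels) (h.arr .marks)) :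
    Halts sweep h (k * (50 * p + 36 * N + 55) + 1) fun h' =>
      Agree [.cnt, .pos, .cur, .nbr, .scan, .lbl, .tmp] [.labels, .marks] h h' ∧
      h'.var .pos = a ∧ IsLabelling adj a N (h'.arr .labels) ∧
      MarksClear a N (h'.arr .labels) (h'.arr .marks) := by
  refine Halts.mono (Halts.for (k := k) (fun k h' =>
    Agree [.cnt, .pos, .cur, .nbr, .scan, .lbl, .tmp] [.labels, .marks] h h' ∧
    a + k ≤ N ∧ h'.var .pos = a + k ∧ IsLabelling adj (a + k) N (h'.arr .labels) ∧
    MarksClear (a + k) N (h'.arr .labels) (h'.arr .marks)) (50 * p + 36 * N + 54) hcnt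
    ⟨Agree.refl _ _ _, hk, hpos, hlab, hmark⟩ ?_ le_rfl) le_rfl (fun h' hh => by simpa using
      ⟨hh.1, hh.2.2⟩)
  clear hpos hcnt hk hlab hmark k
  rintro k h₁ hcnt ⟨hA, hk, hpos, hlab, hmark⟩
  set x := a + k with hx
  have hx1 : a + (k + 1) = x + 1 := by omega
  rw [hx1] at hk hpos hlab hmark
  refine Halts.seq (T₂ := 50 * p + 36 * N + 47) (Halts.block (T := 7) _ (by simp) rfl) ?_ (by omega)
  rintro h₂ rfl
  have hA₂ : Agree [.pos] [] h₁ (([Cmd.subc .pos .pos 1]).foldl (fun h c => c.run h) h₁) :=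
    (Agree.refl _ _ _).block (by decide)
  have hpos₂ : (([Cmd.subc .pos .pos 1]).foldl (fun h c => c.run h) h₁).var .pos = x := by
    simp [Cmd.run, Store.set, hpos]
  generalize ([Cmd.subc .pos .pos 1]).foldl (fun h c => c.run h) h₁ = h₂ at hA₂ hpos₂ ⊢
  have hB₂ := hA.trans (zs := [.cnt, .pos, .cur, .nbr, .scan, .lbl, .tmp])
    (cs := [.labels, .marks]) hA₂ (by simp) (by simp) (by simp) (by simp)
  refine Halts.seq (T₂ := 36 * N + 27) (halts_markNeighbours hG hT (x := x) (N := N)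
    (by rw [hB₂.arr _ (by simp), hR]) (by rw [hB₂.arr _ (by simp), hF])
    (by rw [hB₂.arr _ (by simp), hP x (by omega)]) (by rw [hB₂.var _ (by simp), hN]) hpos₂)
    ?_ (by omega)
  rintro h₃ ⟨hA₃, hm₃⟩
  have hB₃ := hB₂.trans (zs := [.cnt, .pos, .cur, .nbr, .scan, .lbl, .tmp])
    (cs := [.labels, .marks]) hA₃ (by simp) (by simp) (by simp) (by simp)
  refine Halts.seq (T₂ := 13) (halts_relabel (x := x) (N := N)
    (by rw [hB₃.var _ (by simp), hN]) (by rw [hA₃.var _ (by simp), hpos₂]) (by omega))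
    ?_ (by omega)
  rintro h₄ ⟨hA₄, hl₄⟩
  have hB₄ := hB₃.trans (zs := [.cnt, .pos, .cur, .nbr, .scan, .lbl, .tmp])
    (cs := [.labels, .marks]) hA₄ (by simp) (by simp) (by simp) (by simp)
  have hcnt₄ : h₄.var .cnt = k + 1 := by
    rw [hA₄.var _ (by simp), hA₃.var _ (by simp), hA₂.var _ (by simp), hcnt]
  have hpos₄ : h₄.var .pos = x := by
    rw [hA₄.var _ (by simp), hA₃.var _ (by simp), hpos₂]
  have hmarks₄ : h₄.arr .marks = h₃.arr .marks := hA₄.arr _ (by simp)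
  have hlab₃ : h₃.arr .labels = h₁.arr .labels := by
    rw [hA₃.arr _ (by simp), hA₂.arr _ (by simp)]
  rw [hA₂.arr .marks (by simp), hA₂.arr .labels (by simp)] at hm₃
  rw [hlab₃] at hl₄
  have hlow : ∀ z ∈ Set.Ico (x + 1) N, x + 1 ≤ h₁.arr .labels z := fun z hz =>
    (Conn.mem (hlab z hz).1 hz).1
  have hpres : ∀ z ∈ Set.Ico (x + 1) N,
      (h₃.arr .marks (h₁.arr .labels z) ≠ 0 ↔ ∃ w ∈ Set.Ico (x + 1) N, adj x w ∧
        h₁.arr .labels w = h₁.arr .labels z) := fun z hz => by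
    rw [hm₃, hmark.2 z hz]
    simp
  have hmx : h₃.arr .marks x = 0 := by
    by_contra hne
    rcases (hm₃ x).1 hne with h | ⟨w, hw, -, h⟩
    · exact h (hmark.1 x (by omega))
    · have := hlow w hw
      omega
  refine Halts.block _ (by simp) ⟨?_, hB₄.block (by decide), by omega, ?_, ?_, ?_⟩
  · simp [Cmd.run, Store.set, Store.setArr, hcnt₄]
  · simp [Cmd.run, Store.set, Store.setArr, hpos₄]
  · refine IsLabelling.step hG.symm (by omega) hlab
      (marked := fun c => h₃.arr .marks c ≠ 0) hpres ?_ fun z hz => ?_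
    · simp [Cmd.run, Store.set, Store.setArr, hpos₄]
    · have e : z ≠ x := by have := hz.1; omega
      simp only [List.foldl, Cmd.run, Store.set, Store.setArr, Function.update_self, hpos₄]
      rw [Function.update_of_ne e, hl₄ z hz]
      exact ⟨fun h => if_pos h, fun h => if_neg h⟩
  · simp only [List.foldl, Cmd.run, Store.set, Store.setArr, Function.update_self, hpos₄]
    rw [Function.update_of_ne (by simp), hmarks₄]
    refine ⟨fun c hc => ?_, fun z hz => ?_⟩
    · by_contra hne
      rcases (hm₃ c).1 hne with h | ⟨w, hw, -, h⟩
      · exact h (hmark.1 c (by omega))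
      · have := hlow w hw
        omega
    · by_cases e : z = x
      · rw [e, Function.update_self, hmx]
      · have hz' : z ∈ Set.Ico (x + 1) N := ⟨by have := hz.1; omega, hz.2⟩
        rw [Function.update_of_ne e, hl₄ z hz']
        split_ifs with hm
        · exact hmx
        · simpa using hm

theorem halts_fillDescents {a k : ℕ} {h : Store} (hscan : h.var .scan = a) (hcnt : h.var .cnt = k) :
    Halts fillDescents h (k * 32 + 1) fun h' => Agree [.cnt, .scan, .lbl] [.desc] h h' ∧
      ∀ q, h'.arr .desc q =
        if a ≤ q ∧ q < a + k then q - h.arr .labels q else h.arr .desc q := by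
  refine Halts.mono (Halts.for (k := k) (fun j h' => Agree [.cnt, .scan, .lbl] [.desc] h h' ∧
    h'.var .scan + j = a + k ∧ a ≤ h'.var .scan ∧ ∀ q, h'.arr .desc q =
      if a ≤ q ∧ q < h'.var .scan then q - h.arr .labels q else h.arr .desc q) 31 hcnt
    ⟨Agree.refl _ _ _, by omega, by omega, fun q => ?_⟩ ?_ le_rfl) le_rfl ?_
  · rw [hscan, if_neg (by omega)]
  · rintro j h₁ hj ⟨hA, hs, ha, hd⟩
    refine Halts.block _ (by simp) ⟨?_, hA.block (by decide), ?_, ?_, fun q => ?_⟩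
    · simp [Cmd.run, Store.set, Store.setArr, hj]
    · simp [Cmd.run, Store.set, Store.setArr]
      omega
    · simp [Cmd.run, Store.set, Store.setArr]
      omega
    · simp [Cmd.run, Store.set, Store.setArr, Function.update_apply, hA.arr, hd]
      by_cases e : q = h₁.var .scan
      · simp [e, ha]
      · rw [if_neg e]
        congr 1
        simp only [eq_iff_iff]
        omega
  · rintro h' ⟨hA, hs, -, hd⟩
    refine ⟨hA, fun q => ?_⟩
    rw [hd, show h'.var .scan = a + k by omega]

theorem halts_extendDescents {a k : ℕ} {h : Store} (hp : 0 < p) (hpa : p ≤ a)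
    (hper : h.var .per = p) (hscan : h.var .scan = a) (hcnt : h.var .cnt = k) :
    Halts extendDescents h (k * 32 + 1) fun h' => Agree [.cnt, .scan, .lbl] [.desc] h h' ∧
      (∀ q < a, h'.arr .desc q = h.arr .desc q) ∧
      ∀ q, a ≤ q → q < a + k → h'.arr .desc q = h'.arr .desc (q - p) := by
  refine Halts.mono (Halts.for (k := k) (fun j h' => Agree [.cnt, .scan, .lbl] [.desc] h h' ∧
    h'.var .scan + j = a + k ∧ a ≤ h'.var .scan ∧ (∀ q < a, h'.arr .desc q = h.arr .desc q) ∧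
    ∀ q, a ≤ q → q < h'.var .scan → h'.arr .desc q = h'.arr .desc (q - p)) 31 hcnt
    ⟨Agree.refl _ _ _, by omega, by omega, fun _ _ => rfl, fun q _ _ => by omega⟩ ?_ le_rfl)
    le_rfl ?_
  · rintro j h₁ hj ⟨hA, hs, ha, hd, hd'⟩
    have hper₁ : h₁.var .per = p := (hA.var _ (by simp)).trans hper
    refine Halts.block _ (by simp) ⟨?_, hA.block (by decide), ?_, ?_, fun q hq => ?_,
      fun q hq hq' => ?_⟩
    · simp [Cmd.run, Store.set, Store.setArr, hj]
    · simp [Cmd.run, Store.set, Store.setArr]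
      omega
    · simp [Cmd.run, Store.set, Store.setArr]
      omega
    · have e : q ≠ h₁.var .scan := by omega
      simp [Cmd.run, Store.set, Store.setArr, e, hd q hq]
    · simp [Cmd.run, Store.set, Store.setArr] at hq'
      have e : q - p ≠ h₁.var .scan := by omega
      simp [Cmd.run, Store.set, Store.setArr, Function.update_apply, hper₁, e]
      split_ifs with e'
      · rw [e']
      · exact hd' q hq (by omega)
  · rintro h' ⟨hA, hs, -, hd⟩
    rw [show h'.var .scan = a + k by omega] at hd
    exact ⟨hA, hd⟩

/-- Every step of the descent strictly decreases the vertex, so the running time is linear. -/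
theorem halts_descend (hs : ∀ x y, adj x y → adj y x) {w : Var} (hw : w ≠ .cnt) {q : ℕ}
    {h : Store} (hq : h.var w = q) (hd : ∀ r ≤ q, IsDescent adj r (h.arr .desc r)) :
    Halts (descend w) h (14 * q + 8) fun h' => Agree [w, .cnt] [] h h' ∧
      IsLeast {y | Relation.ReflTransGen adj q y} (h'.var w) := by
  refine Halts.seq (Halts.block (T := 7) _ (by simp) rfl) (T₂ := 14 * q + 1) ?_ (by omega)
  rintro h' rfl
  refine Halts.loop (k := q) (fun k h' => k ≤ q ∧ Agree [w, .cnt] [] h h' ∧ h'.var w ≤ k ∧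
    h'.var .cnt = h.arr .desc (h'.var w) ∧ Relation.ReflTransGen adj q (h'.var w)) 13
    ⟨le_rfl, ?_, ?_, ?_, ?_⟩ ?_ ?_ (by omega)
  · exact (Agree.refl _ _ _).block (cs := [.load .cnt .desc w]) (by simp [Cmd.targetsIn])
  · simp [Cmd.run, Store.set, hw, hq]
  · simp [Cmd.run, Store.set, hw]
  · simp [Cmd.run, Store.set, hw, hq]
    exact .refl
  · rintro k h₁ ⟨hk, hA, hle, hc, hr⟩ h0
    have hD := hd (h₁.var w) (by omega)
    have hle' := hD.le
    rw [← hc] at hle'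
    refine ⟨k - 1, by omega, Halts.block _ (by simp) ⟨by omega, ?_, ?_, ?_, ?_⟩⟩
    · exact hA.block (cs := [.sub w w .cnt, .load .cnt .desc w]) (by simp [Cmd.targetsIn])
    · simp [Cmd.run, Store.set, hw]
      omega
    · simp [Cmd.run, Store.set, hw, hA.arr]
    · simp [Cmd.run, Store.set, hw]
      rw [hc]
      exact hr.trans hD.reach
  · rintro k h₁ ⟨hk, hA, hle, hc, hr⟩ h0
    refine ⟨hA, hr, fun y hy => ?_⟩
    exact (hd _ (by omega)).least (hc.symm.trans h0) y ((reflTransGen_symm hs hr).trans hy)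

end Verification

/-! ### The automaton as a transition table -/

section Automaton

variable {n p : ℕ} {A : UnaryAutomaton n}

/-- The edge relation between the words of lengths `x` and `y`. -/
def UnaryAutomaton.adj (A : UnaryAutomaton n) (x y : ℕ) : Prop :=
  A.Edge (List.replicate x ()) (List.replicate y ())

theorem eq_replicate_unit (u : List Unit) : u = List.replicate u.length () :=
  List.eq_replicate_iff.2 ⟨rfl, fun _ _ => rfl⟩

theorem UnaryAutomaton.reachable_iff (A : UnaryAutomaton n) (u v : List Unit) :
    A.Reachable u v ↔ Relation.ReflTransGen A.adj u.length v.length := by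
  constructor
  · intro h
    induction h with
    | refl => exact .refl
    | @tail w w' _ h ih =>
      refine ih.tail ?_
      rwa [UnaryAutomaton.adj, ← eq_replicate_unit, ← eq_replicate_unit]
  · intro h
    have key : ∀ y, Relation.ReflTransGen A.adj u.length y →
        A.Reachable u (List.replicate y ()) := by
      intro y h
      induction h with
      | refl =>
        rw [← eq_replicate_unit]
        exact .refl
      | tail _ h ih => exact ih.tail h
    have := key _ h
    rwa [← eq_replicate_unit] at this

/-- The index of the `(1,1)`-state that is reached after `x` letters `(1,1)`. -/
def mainIndex (p x : ℕ) : ℕ := if x < p then x else p + x % p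

theorem mainIndex_lt (hp : 0 < p) (x : ℕ) : mainIndex p x < 2 * p := by
  have := Nat.mod_lt x hp
  unfold mainIndex
  split_ifs <;> omega

theorem mainIndex_succ (hp : 0 < p) (x : ℕ) : mainIndex p (x + 1) =
    if mainIndex p x + 1 < 2 * p then mainIndex p x + 1 else p := by
  have hlt := Nat.mod_lt x hp
  have h1 : x < p → x % p = x := Nat.mod_eq_of_lt
  have h2 : x % p + 1 < p → (x + 1) % p = x % p + 1 := fun h => by
    rw [← Nat.mod_add_mod, Nat.mod_eq_of_lt h]
  have h3 : x % p + 1 = p → (x + 1) % p = 0 := fun h => by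
    rw [← Nat.mod_add_mod, h, Nat.mod_self]
  have h4 : x < p → (x + 1) % p = 0 ∨ x + 1 < p := fun h => by
    rcases Nat.lt_or_ge (x + 1) p with h' | h'
    · exact .inr h'
    · exact .inl (h3 (by rw [h1 h]; omega))
  simp only [mainIndex]
  split_ifs <;> omega

theorem mainIndex_add (x : ℕ) (hx : p ≤ x) : mainIndex p (x + p) = mainIndex p x := by
  simp [mainIndex, Nat.not_lt.2 hx]

/-- The `(1,1)`-state that is reached after `x` letters `(1,1)`. -/
def mainState (hp : 0 < p) (x : ℕ) : StdState p := .main ⟨mainIndex p x, mainIndex_lt hp x⟩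

theorem next_mainState (hp : 0 < p) (x : ℕ) :
    StdState.next hp (mainState hp x) .both = some (mainState hp (x + 1)) := by
  have h := mainIndex_succ hp x
  simp only [mainState, StdState.next]
  split_ifs at h ⊢ <;> simp [h]

theorem next_rightTail (hp : 0 < p) (i : Fin (2 * p)) (k : Fin p) :
    StdState.next hp (.rightTail i k) .right =
      if h : k.1 + 1 < p then some (.rightTail i ⟨k.1 + 1, h⟩) else none := rfl

/-- Edges are studied through pairs `x ≤ x + d`; the other pairs are covered by symmetry. -/
theorem conv_replicate_add (x d : ℕ) :
    conv (List.replicate x ()) (List.replicate (x + d) ()) =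
      List.replicate x Letter.both ++ List.replicate d Letter.right := by
  induction x with
  | zero =>
    induction d with
    | zero => simp [conv]
    | succ d ih => simpa [List.replicate_succ, conv] using ih
  | succ x ih => simpa [List.replicate_succ, conv, Nat.add_right_comm x 1 d] using ih

section Standard

variable {hp : 0 < p} {e : StdState p ≃ Fin n}

theorem acceptsFrom_main (hstep : ∀ s a, A.step (e s) a = (StdState.next hp s a).map e)
    (x y : ℕ) (w : List Letter) :
    A.AcceptsFrom (e (mainState hp y)) (List.replicate x Letter.both ++ w) ↔
      A.AcceptsFrom (e (mainState hp (y + x))) w := by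
  induction x generalizing y with
  | zero => simp
  | succ x ih =>
    simp only [List.replicate_succ, List.cons_append, UnaryAutomaton.AcceptsFrom, hstep,
      next_mainState, Option.map_some, Option.some.injEq, exists_eq_left']
    rw [ih, Nat.add_right_comm, Nat.add_assoc]

theorem acceptsFrom_rightTail (hstep : ∀ s a, A.step (e s) a = (StdState.next hp s a).map e)
    (i : Fin (2 * p)) (d : ℕ) (k : Fin p) :
    A.AcceptsFrom (e (.rightTail i k)) (List.replicate d Letter.right) ↔
      ∃ h : k.1 + d < p, A.final (e (.rightTail i ⟨k.1 + d, h⟩)) = true := by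
  induction d generalizing k with
  | zero => simp [UnaryAutomaton.AcceptsFrom]
  | succ d ih =>
    simp only [List.replicate_succ, UnaryAutomaton.AcceptsFrom, hstep, next_rightTail]
    split_ifs with h
    · simp only [Option.map_some, Option.some.injEq, exists_eq_left']
      rw [ih]
      simp only [Nat.add_assoc, Nat.add_comm 1 d]
    · simp only [Option.map_none, reduceCtorEq, false_and, exists_false, false_iff, not_exists]
      omega

theorem adj_add_iff (hstart : A.start = e (.main ⟨0, by omega⟩))
    (hstep : ∀ s a, A.step (e s) a = (StdState.next hp s a).map e) (x d : ℕ) :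
    A.adj x (x + d) ↔
      A.AcceptsFrom (e (mainState hp x)) (List.replicate d Letter.right) := by
  have h0 : A.start = e (mainState hp 0) := by simp [hstart, mainState, mainIndex, hp]
  rw [UnaryAutomaton.adj, UnaryAutomaton.Edge, conv_replicate_add, h0, acceptsFrom_main hstep,
    Nat.zero_add]

theorem adj_add_succ_iff (hstart : A.start = e (.main ⟨0, by omega⟩))
    (hstep : ∀ s a, A.step (e s) a = (StdState.next hp s a).map e) (x d : ℕ) :
    A.adj x (x + (d + 1)) ↔ ∃ h : d < p,
      A.final (e (.rightTail ⟨mainIndex p x, mainIndex_lt hp x⟩ ⟨d, h⟩)) = true := by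
  have h1 : StdState.next hp (mainState hp x) .right =
    some (.rightTail ⟨mainIndex p x, mainIndex_lt hp x⟩ ⟨0, hp⟩) := rfl
  rw [adj_add_iff hstart hstep]
  simp only [List.replicate_succ, UnaryAutomaton.AcceptsFrom, hstep, h1, Option.map_some,
    Option.some.injEq, exists_eq_left']
  rw [acceptsFrom_rightTail hstep]
  simp

theorem isPeriodicBand_adj (hstart : A.start = e (.main ⟨0, by omega⟩))
    (hstep : ∀ s a, A.step (e s) a = (StdState.next hp s a).map e)
    (hsymm : ∀ u v, A.Edge u v → A.Edge v u) : IsPeriodicBand A.adj p := by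
  have hs : ∀ x y, A.adj x y → A.adj y x := fun x y => hsymm _ _
  have hshift : ∀ x d, p ≤ x → (A.adj (x + p) (x + d + p) ↔ A.adj x (x + d)) := by
    intro x d hx
    rw [Nat.add_right_comm, adj_add_iff hstart hstep, adj_add_iff hstart hstep]
    simp only [mainState, mainIndex_add x hx]
  refine ⟨hs, fun x y h => ?_, fun x y hx hy => ?_⟩
  · by_contra hlt
    obtain ⟨d, rfl⟩ : ∃ d, y = x + (d + 1) := ⟨y - x - 1, by omega⟩
    obtain ⟨hd, -⟩ := (adj_add_succ_iff hstart hstep x d).1 h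
    omega
  · rcases le_total x y with h | h
    · obtain ⟨d, rfl⟩ := Nat.exists_eq_add_of_le h
      exact hshift x d hx
    · obtain ⟨d, rfl⟩ := Nat.exists_eq_add_of_le h
      exact ⟨fun h => hs _ _ ((hshift y d hy).1 (hs _ _ h)),
        fun h => hs _ _ ((hshift y d hy).2 (hs _ _ h))⟩

theorem isTable_adj (hstart : A.start = e (.main ⟨0, by omega⟩))
    (hstep : ∀ s a, A.step (e s) a = (StdState.next hp s a).map e) {B R F : ℕ → ℕ}
    (hB : ∀ i : Fin n, B (i + 1) = encodeTarget (A.step i .both))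
    (hR : ∀ i : Fin n, R (i + 1) = encodeTarget (A.step i .right))
    (hF : ∀ i : Fin n, F (i + 1) = (A.final i).toNat) :
    IsTable A.adj p (A.start + 1) B R F := by
  have hmain : ∀ x, B^[x] (A.start + 1) = (e (mainState hp x) : ℕ) + 1 := by
    intro x
    induction x with
    | zero => simp [hstart, mainState, mainIndex, hp]
    | succ x ih =>
      rw [Function.iterate_succ_apply', ih, hB, hstep, next_mainState]
      rfl
  have htail : ∀ x k, ∀ hk : k < p, R^[k + 1] (B^[x] (A.start + 1)) =
      (e (.rightTail ⟨mainIndex p x, mainIndex_lt hp x⟩ ⟨k, hk⟩) : ℕ) + 1 := by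
    intro x k
    induction k with
    | zero =>
      intro hk
      rw [hmain, Function.iterate_one, hR, hstep]
      rfl
    | succ k ih =>
      intro hk
      rw [Function.iterate_succ_apply', ih (by omega), hR, hstep, next_rightTail, dif_pos hk]
      rfl
  refine ⟨fun x k hk => ?_, fun x => ?_, fun x k hk => ?_⟩
  · rw [htail x k hk]
    omega
  · obtain ⟨q, rfl⟩ : ∃ q, p = q + 1 := ⟨p - 1, by omega⟩
    rw [Function.iterate_succ_apply', htail x q (by omega), hR, hstep, next_rightTail,
      dif_neg (by simp)]
    rfl
  · rw [htail x k hk, hF, adj_add_succ_iff hstart hstep]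
    simp [hk]

/-- The three kinds of states of a standard one-loop automaton. -/
def StdState.equivSum (p : ℕ) :
    StdState p ≃ Fin (2 * p) ⊕ Fin (2 * p) × Fin p ⊕ Fin (2 * p) × Fin p where
  toFun
    | main i => .inl i
    | leftTail i k => .inr (.inl (i, k))
    | rightTail i k => .inr (.inr (i, k))
  invFun
    | .inl i => main i
    | .inr (.inl (i, k)) => leftTail i k
    | .inr (.inr (i, k)) => rightTail i k
  left_inv s := by cases s <;> rfl
  right_inv s := by rcases s with _ | _ | _ <;> rfl

theorem card_states (e : StdState p ≃ Fin n) : n = 2 * p + (2 * p * p + 2 * p * p) := by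
  simpa using Fintype.card_congr (e.symm.trans (StdState.equivSum p))

end Standard

end Automaton

/-! ### The whole program -/

/-- Read the input. -/
def readInput : RAM.Prog :=
  .seq readTable <| .seq findPeriod <| .seq (readWord .lhs) (readWord .rhs)

/-- Compute the table of descents for all vertices up to `3 p + lhs + rhs`. On `[2p, 3p)` they come
from the components of the graph on `[p, (p + 2) p)`, below `2p` from those of the graph on
`[0, (p + 2) p)`. -/
def computeDescents : RAM.Prog :=
  .seq computeSize <| .seq computePath <|
    .seq (block [.sub .cnt .size .per]) <| .seq sweep <|
    .seq (block [.add .scan .per .per, .copy .cnt .per]) <| .seq fillDescents <|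
    .seq (block [.copy .cnt .per]) <| .seq sweep <|
    .seq (block [.const .scan 0, .add .cnt .per .per]) <| .seq fillDescents <|
    .seq (block [.add .scan .per .per, .add .scan .scan .per, .add .cnt .lhs .rhs,
      .addc .cnt .cnt 1]) extendDescents

/-- The program that decides reachability. -/
def reachabilityProgram : RAM.Prog :=
  .seq readInput <| .seq computeDescents <| .seq (descend .lhs) <| .seq (descend .rhs) testEqual

theorem halts_computeDescents {adj : ℕ → ℕ → Prop} {p start U V : ℕ} {B R F : ℕ → ℕ} (hp : 0 < p)
    (hG : IsPeriodicBand adj p) (hT : IsTable adj p start B R F) {h : Store}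
    (hper : h.var .per = p) (hcur : h.var .cur = start) (hB : h.arr .both = B)
    (hR : h.arr .right = R) (hF : h.arr .final = F) (hU : h.var .lhs = U) (hV : h.var .rhs = V)
    (hM : ∀ c, h.arr .marks c = 0) :
    Halts computeDescents h (1000 * p ^ 4 + 32 * (U + V) + 250) fun h' =>
      h'.var .lhs = U ∧ h'.var .rhs = V ∧ ∀ q ≤ U + V, IsDescent adj q (h'.arr .desc q) := by
  set N := (p + 2) * p with hN
  have hpN : p ≤ N := by nlinarith
  have hN' : N ≤ 3 * p ^ 2 := by nlinarith
  have hppN : p + p + p ≤ N := by nlinarith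
  -- The variables and arrays that the parts may modify; everything else keeps its value from `h`.
  let xs : List Var := [.size, .cnt, .pos, .cur, .nbr, .scan, .lbl, .tmp]
  let as : List Arr := [.path, .labels, .marks, .desc]
  have step : ∀ {ys : List Var} {bs : List Arr} {h₁ h₂ : Store}, Agree xs as h h₁ →
      Agree ys bs h₁ h₂ → ys ⊆ xs → bs ⊆ as → Agree xs as h h₂ :=
    fun H H' hy hb => H.trans H' (List.Subset.refl _) hy (List.Subset.refl _) hb
  -- The running times of the two sweeps and of the periodic continuation.
  obtain ⟨S₁, hS₁⟩ : ∃ S, S = (N - p) * (50 * p + 36 * N + 55) + 1 := ⟨_, rfl⟩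
  obtain ⟨S₂, hS₂⟩ : ∃ S, S = p * (50 * p + 36 * N + 55) + 1 := ⟨_, rfl⟩
  obtain ⟨W, hW⟩ : ∃ W, W = (U + V + 1) * 32 + 1 := ⟨_, rfl⟩
  have hbound : 14 * (p + 2) + 14 + (S₁ + S₂ + 26 * N + 96 * p + 81 + W) ≤
      1000 * p ^ 4 + 32 * (U + V) + 250 := by
    have h1 : (N - p) * (50 * p + 36 * N + 55) + p * (50 * p + 36 * N + 55) =
        N * (50 * p + 36 * N + 55) := by
      rw [← Nat.add_mul, Nat.sub_add_cancel hpN]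
    have h2 : p ≤ p ^ 2 := Nat.le_self_pow two_ne_zero p
    have h3 : p ^ 2 ≤ p ^ 4 := Nat.pow_le_pow_right hp (by norm_num)
    have h4 : N * (50 * p + 36 * N + 55) ≤ 3 * p ^ 2 * (213 * p ^ 2) :=
      Nat.mul_le_mul hN' (by omega)
    have h5 : 3 * p ^ 2 * (213 * p ^ 2) = 639 * p ^ 4 := by ring
    omega
  clear hN'
  refine Halts.seq (T₂ := S₁ + S₂ + 26 * N + 96 * p + 81 + W) (halts_computeSize hper) ?_ hbound
  clear hbound
  rintro h₁ ⟨hA₁, hsize₁⟩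
  have hH₁ := step (Agree.refl _ _ _) hA₁ (by simp [xs]) (by simp [as])
  refine Halts.seq (T₂ := S₁ + S₂ + 96 * p + 67 + W)
    (halts_computePath (N := N) ((hH₁.arr _ (by simp [as])).trans hB)
    ((hA₁.var _ (by simp)).trans hcur) hsize₁) ?_ (by omega)
  rintro h₂ ⟨hA₂, hpos₂, hpath₂⟩
  have hH₂ := step hH₁ hA₂ (by simp [xs]) (by simp [as])
  have hsize₂ : h₂.var .size = N := (hA₂.var _ (by simp)).trans hsize₁
  have hmarks₂ : ∀ c, h₂.arr .marks c = 0 := fun c => by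
    rw [hA₂.arr _ (by simp), hA₁.arr _ (by simp), hM]
  refine Halts.seq (T₂ := S₁ + S₂ + 96 * p + 60 + W) (Halts.block (T := 7) _ (by simp) rfl) ?_
    (by omega)
  rintro h₃ e₃
  have hA₃ : Agree [.cnt] [] h₂ h₃ := e₃ ▸ (Agree.refl _ _ _).block (by decide)
  have hcnt₃ : h₃.var .cnt = N - p := by
    simp [← e₃, Cmd.run, Store.set, hsize₂, hH₂.var .per (by simp [xs]), hper]
  have hH₃ := step hH₂ hA₃ (by simp [xs]) (by simp [as])
  have hsize₃ : h₃.var .size = N := (hA₃.var _ (by simp)).trans hsize₂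
  have eN : p + (N - p) = N := by omega
  -- The labelling of the empty interval starts the sweep.
  refine Halts.seq (T₂ := S₂ + 96 * p + 60 + W) (halts_sweep hG hT (N := N) (a := p) (k := N - p)
    ((hH₃.arr _ (by simp [as])).trans hR) ((hH₃.arr _ (by simp [as])).trans hF)
    (fun x hx => (congrFun (hA₃.arr .path (by simp)) x).trans (hpath₂ x hx)) hsize₃
    (by rw [hA₃.var _ (by simp), hpos₂, eN]) hcnt₃ (by omega)
    (fun z hz => absurd hz.2 (by have := hz.1; omega))
    ⟨fun c _ => by rw [hA₃.arr _ (by simp), hmarks₂],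
      fun z _ => by rw [hA₃.arr .marks (by simp), hmarks₂]⟩) ?_ (by omega)
  rintro h₄ ⟨hA₄, hpos₄, hlab₄, hmark₄⟩
  have hH₄ := step hH₃ hA₄ (by simp [xs]) (by simp [as])
  have hper₄ : h₄.var .per = p := (hH₄.var _ (by simp [xs])).trans hper
  refine Halts.seq (T₂ := S₂ + 96 * p + 47 + W) (Halts.block (T := 13) _ (by simp) rfl) ?_
    (by omega)
  rintro h₅ e₅
  have hA₅ : Agree [.cnt, .scan] [] h₄ h₅ := e₅ ▸ (Agree.refl _ _ _).block (by decide)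
  refine Halts.seq (T₂ := S₂ + 64 * p + 46 + W) (halts_fillDescents (a := p + p) (k := p)
    (by simp [← e₅, Cmd.run, Store.set, hper₄])
    (by simp [← e₅, Cmd.run, Store.set, hper₄])) ?_ (by omega)
  rintro h₆ ⟨hA₆, hdesc₆⟩
  have hH₆ := step (step hH₄ hA₅ (by simp [xs]) (by simp [as])) hA₆ (by simp [xs]) (by simp [as])
  have hlab₆ : h₆.arr .labels = h₄.arr .labels := by
    rw [hA₆.arr _ (by simp), hA₅.arr _ (by simp)]
  have hmarks₆ : h₆.arr .marks = h₄.arr .marks := by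
    rw [hA₆.arr _ (by simp), hA₅.arr _ (by simp)]
  have hper₆ : h₆.var .per = p := (hH₆.var _ (by simp [xs])).trans hper
  have hpos₆ : h₆.var .pos = p := by
    rw [hA₆.var _ (by simp), hA₅.var _ (by simp), hpos₄]
  rw [hA₅.arr .labels (by simp)] at hdesc₆
  refine Halts.seq (T₂ := S₂ + 64 * p + 39 + W) (Halts.block (T := 7) _ (by simp) rfl) ?_ (by omega)
  rintro h₇ e₇
  have hA₇ : Agree [.cnt] [] h₆ h₇ := e₇ ▸ (Agree.refl _ _ _).block (by decide)
  have hH₇ := step hH₆ hA₇ (by simp [xs]) (by simp [as])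
  have hlab₇ : h₇.arr .labels = h₄.arr .labels := (hA₇.arr _ (by simp)).trans hlab₆
  have hmarks₇ : h₇.arr .marks = h₄.arr .marks := (hA₇.arr _ (by simp)).trans hmarks₆
  have hpath₇ : h₇.arr .path = h₂.arr .path := by
    rw [hA₇.arr _ (by simp), hA₆.arr _ (by simp), hA₅.arr _ (by simp), hA₄.arr _ (by simp),
      hA₃.arr _ (by simp)]
  have hsize₇ : h₇.var .size = N := by
    rw [hA₇.var _ (by simp), hA₆.var _ (by simp), hA₅.var _ (by simp), hA₄.var _ (by simp),
      hsize₃]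
  refine Halts.seq (T₂ := 64 * p + 39 + W) (halts_sweep hG hT (N := N) (a := 0) (k := p)
    ((hH₇.arr _ (by simp [as])).trans hR) ((hH₇.arr _ (by simp [as])).trans hF)
    (fun x hx => (congrFun hpath₇ x).trans (hpath₂ x hx)) hsize₇
    (by rw [hA₇.var _ (by simp), hpos₆, Nat.zero_add])
    (by simp [← e₇, Cmd.run, Store.set, hper₆]) (by omega)
    (by rw [hlab₇, Nat.zero_add]; exact hlab₄)
    (by rw [hlab₇, hmarks₇, Nat.zero_add]; exact hmark₄)) ?_ (by omega)
  rintro h₈ ⟨hA₈, -, hlab₈, -⟩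
  have hH₈ := step hH₇ hA₈ (by simp [xs]) (by simp [as])
  have hper₈ : h₈.var .per = p := (hH₈.var _ (by simp [xs])).trans hper
  refine Halts.seq (T₂ := 64 * p + 26 + W) (Halts.block (T := 13) _ (by simp) rfl) ?_ (by omega)
  rintro h₉ e₉
  have hA₉ : Agree [.cnt, .scan] [] h₈ h₉ := e₉ ▸ (Agree.refl _ _ _).block (by decide)
  refine Halts.seq (T₂ := 25 + W) (halts_fillDescents (a := 0) (k := p + p)
    (by simp [← e₉, Cmd.run, Store.set])
    (by simp [← e₉, Cmd.run, Store.set, hper₈])) ?_ (by omega)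
  rintro h₁₀ ⟨hA₁₀, hdesc₁₀⟩
  have hH₁₀ := step (step hH₈ hA₉ (by simp [xs]) (by simp [as])) hA₁₀ (by simp [xs])
    (by simp [as])
  have hper₁₀ : h₁₀.var .per = p := (hH₁₀.var _ (by simp [xs])).trans hper
  have hU₁₀ : h₁₀.var .lhs = U := (hH₁₀.var _ (by simp [xs])).trans hU
  have hV₁₀ : h₁₀.var .rhs = V := (hH₁₀.var _ (by simp [xs])).trans hV
  rw [hA₉.arr .labels (by simp), hA₉.arr .desc (by simp), hA₈.arr .desc (by simp),
    hA₇.arr .desc (by simp)] at hdesc₁₀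
  refine Halts.seq (T₂ := W) (Halts.block (T := 25) _ (by simp) rfl) ?_ (by omega)
  rintro h₁₁ e₁₁
  have hA₁₁ : Agree [.cnt, .scan] [] h₁₀ h₁₁ := e₁₁ ▸ (Agree.refl _ _ _).block (by decide)
  have hH₁₁ := step hH₁₀ hA₁₁ (by simp [xs]) (by simp [as])
  refine Halts.mono (halts_extendDescents (p := p) (a := p + p + p) (k := U + V + 1) hp (by omega)
    ((hH₁₁.var _ (by simp [xs])).trans hper)
    (by simp [← e₁₁, Cmd.run, Store.set, hper₁₀])
    (by simp [← e₁₁, Cmd.run, Store.set, hU₁₀, hV₁₀])) (by omega) ?_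
  · rintro h₁₂ ⟨hA₁₂, hlow, hhigh⟩
    have hH₁₂ := step hH₁₁ hA₁₂ (by simp [xs]) (by simp [as])
    refine ⟨(hH₁₂.var _ (by simp [xs])).trans hU, (hH₁₂.var _ (by simp [xs])).trans hV,
      fun q hq => ?_⟩
    rw [hA₁₁.arr .desc (by simp)] at hlow
    refine hG.isDescent_of_periodic hp hlab₈ hlab₄ (M := U + V) (fun q hq => ?_)
      (fun q hq hq' => ?_) (fun q hq hq' => hhigh q hq (by omega)) q hq
    · rw [hlow q (by omega), hdesc₁₀, if_pos (by omega)]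
    · rw [hlow q hq', hdesc₁₀, if_neg (by omega), hdesc₆, if_pos ⟨hq, by omega⟩]

theorem halts_readInput {n p : ℕ} {A : UnaryAutomaton n} {hp : 0 < p} {e : StdState p ≃ Fin n}
    (hstart : A.start = e (.main ⟨0, by omega⟩))
    (hstep : ∀ s a, A.step (e s) a = (StdState.next hp s a).map e) (u v : List Unit) {h : Store}
    (hin : h.input = encodeInput A u v) (hvar : ∀ x, h.var x = 0) :
    Halts readInput h (56 * n + 14 * p + 14 * (u.length + v.length) + 50) fun h' =>
      h'.var .per = p ∧ h'.var .cur = A.start + 1 ∧ h'.var .lhs = u.length ∧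
      h'.var .rhs = v.length ∧ h'.arr .marks = h.arr .marks ∧
      IsTable A.adj p (A.start + 1) (h'.arr .both) (h'.arr .right) (h'.arr .final) := by
  refine Halts.seq (T₂ := 14 * p + 14 * (u.length + v.length) + 24) (halts_readTable
    (fun i => encodeTarget (A.step i .both)) (fun i => encodeTarget (A.step i .left))
    (fun i => encodeTarget (A.step i .right)) (fun i => (A.final i).toNat)
    (encodeWord u ++ encodeWord v) (n := n) (s := A.start)
    (by simp [hin, encodeInput, UnaryAutomaton.encode]) (hvar _)) ?_ (by omega)
  rintro h₁ ⟨hA₁, hin₁, hcur₁, hrow⟩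
  have hT : IsTable A.adj p (A.start + 1) (h₁.arr .both) (h₁.arr .right) (h₁.arr .final) :=
    isTable_adj hstart hstep (fun i => (hrow i).1) (fun i => (hrow i).2.1) fun i => (hrow i).2.2
  refine Halts.seq (T₂ := 14 * (u.length + v.length) + 16) (halts_findPeriod hT rfl hcur₁
    ((hA₁.var _ (by simp)).trans (hvar _))) ?_ (by omega)
  rintro h₂ ⟨hA₂, hin₂, hper₂⟩
  refine Halts.seq (T₂ := 14 * v.length + 8) (halts_readWord (by simp) u (encodeWord v)
    (hin₂.trans hin₁) (by rw [hA₂.var _ (by simp), hA₁.var _ (by simp), hvar])) ?_ (by omega)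
  rintro h₃ ⟨hA₃, hin₃, hlhs₃⟩
  refine Halts.mono (halts_readWord (by simp) v [] (by simpa using hin₃)
    (by rw [hA₃.var _ (by simp), hA₂.var _ (by simp), hA₁.var _ (by simp), hvar])) le_rfl ?_
  rintro h₄ ⟨hA₄, -, hrhs₄⟩
  have harr : h₄.arr = h₁.arr := funext fun a => by
    rw [hA₄.arr a (by simp), hA₃.arr a (by simp), hA₂.arr a (by simp)]
  refine ⟨?_, ?_, ?_, hrhs₄, ?_, ?_⟩
  · rw [hA₄.var _ (by simp), hA₃.var _ (by simp), hper₂]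
  · rw [hA₄.var _ (by simp), hA₃.var _ (by simp), hA₂.var _ (by simp), hcur₁]
  · rw [hA₄.var _ (by simp), hlhs₃]
  · rw [harr, hA₁.arr _ (by simp)]
  · rw [harr]
    exact hT

/-- Two vertices of an undirected graph are connected if and only if their components have the same
least vertex. -/
theorem isLeast_component_eq_iff {adj : ℕ → ℕ → Prop} (hs : ∀ x y, adj x y → adj y x)
    {x y a b : ℕ} (ha : IsLeast {z | Relation.ReflTransGen adj x z} a)
    (hb : IsLeast {z | Relation.ReflTransGen adj y z} b) :
    a = b ↔ Relation.ReflTransGen adj x y := by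
  constructor
  · rintro rfl
    exact ha.1.trans (reflTransGen_symm hs hb.1)
  · intro h
    exact le_antisymm (ha.2 (h.trans hb.1)) (hb.2 ((reflTransGen_symm hs h).trans ha.1))

theorem halts_reachabilityProgram {n p : ℕ} {A : UnaryAutomaton n} (hA : A.IsStandardOneLoop p)
    (hsymm : ∀ u v : List Unit, A.Edge u v → A.Edge v u) (u v : List Unit) {h : Store}
    (hin : h.input = encodeInput A u v) (hvar : ∀ x, h.var x = 0)
    (hmarks : ∀ c, h.arr .marks c = 0) :
    Halts reachabilityProgram h (2000 * (u.length + v.length + p ^ 4)) fun h' =>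
      (A.Reachable u v → h'.var .out = 1) ∧ (¬ A.Reachable u v → h'.var .out = 0) := by
  obtain ⟨hp, e, hstart, hstep⟩ := hA
  have hG := isPeriodicBand_adj hstart hstep hsymm
  have hn : 56 * n ≤ 400 * p ^ 4 := by
    have h2 : p ≤ p ^ 2 := Nat.le_self_pow two_ne_zero p
    have h3 : p ^ 2 ≤ p ^ 4 := Nat.pow_le_pow_right hp (by norm_num)
    have h4 : n = 2 * p + 4 * p ^ 2 := by rw [card_states e]; ring
    omega
  have hp4 : p ≤ p ^ 4 := Nat.le_self_pow (by norm_num) p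
  generalize hP : p ^ 4 = P at hn hp4 ⊢
  refine Halts.seq (T₂ := 1000 * P + 46 * (u.length + v.length) + 350)
    (halts_readInput hstart hstep u v hin hvar) ?_ (by omega)
  rintro h₁ ⟨hper, hcur, hlhs, hrhs, hmarks₁, hT⟩
  refine Halts.seq (T₂ := 14 * (u.length + v.length) + 60)
    (halts_computeDescents hp hG hT hper hcur rfl rfl rfl hlhs hrhs
      (fun c => by rw [hmarks₁, hmarks])) ?_ (by rw [hP]; omega)
  rintro h₂ ⟨hlhs₂, hrhs₂, hd⟩
  refine Halts.seq (T₂ := 14 * v.length + 40) (halts_descend hG.symm (by simp) hlhs₂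
    fun r hr => hd r (by omega)) ?_ (by omega)
  rintro h₃ ⟨hA₃, hl₃⟩
  refine Halts.seq (T₂ := 31) (halts_descend hG.symm (q := v.length) (by simp)
    ((hA₃.var _ (by simp)).trans hrhs₂) fun r hr => by
      rw [hA₃.arr _ (by simp)]
      exact hd r (by omega)) ?_ (by omega)
  rintro h₄ ⟨hA₄, hl₄⟩
  rw [← hA₄.var .lhs (by simp)] at hl₃
  have hiff := isLeast_component_eq_iff hG.symm hl₃ hl₄
  refine Halts.block _ (by simp) ?_
  rw [A.reachable_iff, ← hiff]
  constructor
  · intro heq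
    simp [Cmd.run, Store.set, heq]
  · intro hne
    simp [Cmd.run, Store.set]
    omega

theorem represents_init (w : List ℕ) :
    Represents (RAM.init w) ⟨fun _ => 0, fun _ _ => 0, w⟩ :=
  ⟨fun _ => rfl, fun _ _ => rfl, rfl⟩

theorem mainTheorem1 :
    ∃ (P : RAM.Prog) (C : ℕ), ∀ (n p : ℕ) (A : UnaryAutomaton n),
      A.IsStandardOneLoop p → (∀ u v : List Unit, A.Edge u v → A.Edge v u) →
        ∀ u v : List Unit, ∃ (t : ℕ) (s : RAM.State),
          RAM.Exec P (RAM.init (encodeInput A u v)) t s ∧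
          t ≤ C * (u.length + v.length + p ^ 4) ∧
          (A.Reachable u v → s.reg 0 = 1) ∧
          (¬ A.Reachable u v → s.reg 0 = 0) := by
  refine ⟨reachabilityProgram, 2000, fun n p A hA hsymm u v => ?_⟩
  obtain ⟨t, s, h, he, ht, hr, h1, h0⟩ := halts_reachabilityProgram hA hsymm u v
    (h := ⟨fun _ => 0, fun _ _ => 0, _⟩) rfl (fun _ => rfl) (fun _ => rfl) _ (represents_init _)
  have hout : s.reg 0 = h.var .out := hr.var .out
  exact ⟨t, s, he, ht, fun hR => hout.trans (h1 hR), fun hR => hout.trans (h0 hR)⟩
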